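/- **Proposition 3.1.** For $x\in\mathbb R$ write $\langle x\rangle=(1+x^2)^{1/2}$. Consider frequencies $(\xi_0,\xi_1,\dots,\xi_5)\in\mathbb R^6$, $\xi=\xi_0$, and the resonance function $$\Phi=\xi^3-\sum_{j=1}^5\xi_j^3 .$$ For $c>0$ and $\sigma\in\mathbb R$ let $$\Gamma^{\sigma}=\Big\{(\xi_0,\dots,\xi_5)\in\mathbb R^6:\ \xi_0+\sigma=\sum_{j=1}^5\xi_j,\quad |\sigma|\le c\min_{1\le j\le 5}|\xi_j|\Big\}.$$ For $B\subset\{0,\dots,5\}$ nonempty and fixed $\xi_j$, $j\notin B$, $\int_{\Gamma^\sigma}F\,d\xi_{j\in B}$ denotes the integral of $F\ge0$ over the corresponding slice of $\Gamma^\sigma$ with respect to Lebesgue measure in all but one of the variables $\xi_j$, $j\in B$, the remaining one being determined by $\xi_0+\sigma=\sum_{j=1}^5\xi_j$ (the value does not depend on which variable is eliminated; if $B$ has one element, the integral is the value of $\mathbb 1_{\Gamma^\sigma}F$ at the single point determined by this equation). Let $s>0$ and $\epsilon<\min\{4s,1\}$. Then the flexible frequency-restricted estimate holds, that is: for every $c>0$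 there is a finite cover of $\mathbb R^6$ by measurable regions such that for each region $R$ there exist a set $\emptyset\ne A\subsetneq\{0,\dots,5\}$ and real numbers $s_j,s_j'$ ($0\le j\le5$), $\epsilon_0,\epsilon_0'$ with $$s_j+s_j'=2s\quad(0\le j\le 5),\qquad \epsilon_0+\epsilon_0'=2\epsilon,$$ and constants $C,\delta>0$ such that, for all $M\ge1$, $$\sup_{\sigma,\alpha,\,\xi_{j\in A}}\int_{\Gamma^\sigma}\frac{|\xi|\,\langle\xi\rangle^{s_0+\epsilon_0}}{\prod_{j=1}^5\langle\xi_j\rangle^{s_j}}\,\mathbb 1_R\,\mathbb 1_{|\Phi-\alpha|<M}\,d\xi_{j\notin A}\le C M^{1-\delta}$$ and $$\sup_{\sigma,\alpha,\,\xi_{j\notin A}}\int_{\Gamma^\sigma}\frac{|\xi|\,\langle\xi\rangle^{s_0'+\epsilon_0'}}{\prod_{j=1}^5\langle\xi_j\rangle^{s_j'}}\,\mathbb 1_R\,\mathbb 1_{|\Phi-\alpha|<M}\,d\xi_{j\in A}\le C M^{1-\delta},$$ where the suprema run over all real $\sigma$, $\alpha$ and all real values of the frozen frequencies. -/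

import Mathlib

open scoped ENNReal

noncomputable section

namespace FlexFRE

/-- The Japanese bracket `⟨x⟩ = (1 + x²)^{1/2}`. -/
def jap (x : ℝ) : ℝ := Real.sqrt (1 + x ^ 2)

/-- A frequency vector of a nonlinearity of order `k` in one space dimension is
`ζ = (ξ, ξ₁, …, ξ_k) : Fin (k + 1) → ℝ`: `ζ 0 = ξ` is the outgoing frequency and
`ζ j.succ`, `j : Fin k`, are the ingoing ones. This is the convolution hyperplane with
deformation `σ`, together with the condition `min_{1 ≤ j ≤ k} |ξ_j| ≳ |σ|`, whose implicit
constant is the parameter `c`. -/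
def Gam {k : ℕ} (c σ : ℝ) : Set (Fin (k + 1) → ℝ) :=
  {ζ | ζ 0 + σ = ∑ j : Fin k, ζ j.succ ∧ ∀ j : Fin k, |σ| ≤ c * |ζ j.succ|}

/-- The coefficients of the linear form `-ξ + ξ₁ + ⋯ + ξ_k`. -/
def sgn {k : ℕ} (j : Fin (k + 1)) : ℝ := if j = 0 then -1 else 1

/-- The point of the hyperplane `-ξ + ξ₁ + ⋯ + ξ_k = σ` whose coordinates outside `B` are those
of `x`, whose coordinates in `B \ {p}` are those of `y`, and whose coordinate `p` is determined
by the equation of the hyperplane. (The coordinates of `x` in `B` play no role when `p ∈ B`.) -/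
def slicePoint {k : ℕ} (B : Finset (Fin (k + 1))) (p : Fin (k + 1)) (σ : ℝ)
    (x : Fin (k + 1) → ℝ) (y : ↥(B.erase p) → ℝ) : Fin (k + 1) → ℝ :=
  let w : Fin (k + 1) → ℝ := fun j => if h : j ∈ B.erase p then y ⟨j, h⟩ else x j
  Function.update w p (sgn p * (σ - ∑ j ∈ Finset.univ.erase p, sgn j * w j))

/-- The integral `∫_{Γ_ξ^σ} F dξ_{j ∈ B}`, the frequencies `ξ_{j ∉ B}` being frozen at the values
given by `x`: Lebesgue integration over the slice of the hyperplane, parametrized by all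
coordinates in `B` but one, `p ∈ B`. Since the coefficients of the hyperplane are `±1`, the value
does not depend on the choice of `p`. If `B = {p}`, the slice is a single point and the integral
is evaluation at that point. -/
def sliceIntegral {k : ℕ} (c : ℝ) (B : Finset (Fin (k + 1))) (p : Fin (k + 1)) (σ : ℝ)
    (x : Fin (k + 1) → ℝ) (F : (Fin (k + 1) → ℝ) → ℝ≥0∞) : ℝ≥0∞ :=
  ∫⁻ y : ↥(B.erase p) → ℝ, (Gam c σ).indicator F (slicePoint B p σ x y)

/-- The weight `|m| ⟨ξ⟩^{a₀ + e} / ∏_{j=1}^k ⟨ξ_j⟩^{a_j}`. -/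
def weight {k : ℕ} (m : (Fin (k + 1) → ℝ) → ℝ) (a : Fin (k + 1) → ℝ) (e : ℝ)
    (ζ : Fin (k + 1) → ℝ) : ℝ :=
  |m ζ| * jap (ζ 0) ^ (a 0 + e) / ∏ j : Fin k, jap (ζ j.succ) ^ (a j.succ)

/-- The frequency-restricted estimate on the region `R`:
`sup_{σ, α, ξ_{j ∉ B}} ∫_{Γ_ξ^σ} W 𝟙_R 𝟙_{|Φ - α| < M} dξ_{j ∈ B} ≲ M^{1⁻}` for all `M ≥ 1`,
where `M^{1⁻}` stands for `M ^ (1 - δ)` with some `δ > 0`. -/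
def RestrictedEstimate {k : ℕ} (c : ℝ) (Φ W : (Fin (k + 1) → ℝ) → ℝ)
    (R : Set (Fin (k + 1) → ℝ)) (B : Finset (Fin (k + 1))) : Prop :=
  ∃ p ∈ B, ∃ C > (0 : ℝ), ∃ δ > (0 : ℝ), ∀ M : ℝ, 1 ≤ M →
    ∀ (σ α : ℝ) (x : Fin (k + 1) → ℝ),
      sliceIntegral c B p σ x
          ((R ∩ {ζ | |Φ ζ - α| < M}).indicator fun ζ => ENNReal.ofReal (W ζ))
        ≤ ENNReal.ofReal (C * M ^ (1 - δ))

/-- The flexible frequency-restricted estimate with multiplier `m` and resonance function `Φ`,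
at regularity `s` with gain `ε`. It is required for every value `c` of the implicit constant in
the definition of `Γ_ξ^σ`. The frequency space may be split into finitely many measurable
regions, and the set `A` and the exponents may depend on the region. -/
def FlexibleEstimate {k : ℕ} (m Φ : (Fin (k + 1) → ℝ) → ℝ) (s ε : ℝ) : Prop :=
  ∀ c > (0 : ℝ), ∃ (n : ℕ) (R : Fin n → Set (Fin (k + 1) → ℝ)),
    (∀ i, MeasurableSet (R i)) ∧ (⋃ i, R i) = Set.univ ∧
    ∀ i, ∃ A : Finset (Fin (k + 1)), A.Nonempty ∧ A ≠ Finset.univ ∧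
      ∃ (a a' : Fin (k + 1) → ℝ) (e e' : ℝ),
        (∀ j, a j + a' j = 2 * s) ∧ e + e' = 2 * ε ∧
        RestrictedEstimate c Φ (weight m a e) (R i) Aᶜ ∧
        RestrictedEstimate c Φ (weight m a' e') (R i) A

/-- The resonance function `Φ = ξ³ - ∑_{j=1}^k ξ_j³` of the generalized KdV equation. -/
def kdvResonance {k : ℕ} (ζ : Fin (k + 1) → ℝ) : ℝ := ζ 0 ^ 3 - ∑ j : Fin k, ζ j.succ ^ 3

/-- The multiplier `ξ` of the generalized KdV equation. -/
def kdvMultiplier {k : ℕ} (ζ : Fin (k + 1) → ℝ) : ℝ := ζ 0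

end FlexFRE

end

/-!
In the signed frequencies `z_0 = -ξ`, `z_j = ξ_j` the hyperplane is `∑ z_j = σ` and the resonance
function is `Φ = -∑ z_j³`, so all six frequencies play the same role in `Φ`. Only sets `A` with
three elements are used. Over a triple `{p, q, r}` of unfrozen frequencies, fix `z_r`; then
`z_p + z_q` is fixed as well and `Φ` is quadratic in `z_q` with derivative `3 (z_p² - z_q²)`.
Hence, with `N = ‖ζ‖` the largest frequency, the set `|Φ - α| < M` has measure
`O(min (N, M / d))` in `z_q` wherever `|z_p² - z_q²| ≥ d`, and interpolating between the two bounds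
gives the power `M ^ (1 - δ)` at the price of `N ^ δ` (`volume_fiber_le`). There is room for this
loss because `4 s - ε > 0`.

The remaining integral in `z_r` is one of the following.

* Nonstationary (`restrictedEstimate_of_nonstationary`): `d` is comparable to `N²`, and the weight
  is at most `N ^ (1 + ε) |z_r| ^ (-4 s)`, which is integrable at `z_r = 0` if `s < 1 / 4`.
* Possibly stationary (`finCov_stationary`): the triple contains a frequency of size `N` and the
  weight is at most `N ^ (1 + ε - 4 s)`. If `p`, `q` is the pair with the largest difference
  `|z_p - z_q|`, and `S = z_p + z_q + z_r` is the conserved sum, then either `|z_p - z_q|` is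
  comparable to `N` and `d` can be taken as `N |z_r - S|`, or the three numbers nearly agree and `d`
  can be taken as `N |z_r - S / 3|`. Near a stationary point of `Φ` this costs only a logarithm,
  which is absorbed in the power of `N`.

It remains to split the six frequencies into two triples of these types (`exists_region`). If all
ingoing frequencies are comparable to `N`, any splitting into two stationary triples works.
Otherwise `σ`, being bounded by the smallest ingoing frequency, is negligible, and the sum of the
large `z_j` nearly vanishes. If four are large ingoing ones, this excludes that all absolute values
agree, as a sum of five signs is odd; this provides a nonstationary triple, and the other triple
is treated as a stationary one. If three are large, a large and a small ingoing frequency form a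
nonstationary pair. If at most two are large, both triples are nonstationary. The exponents
`s_j`, `s_j'` are distributed so that each weight takes the form above.

Since the outgoing frequency is controlled by the ingoing ones, the estimate is monotone in `s` and
`ε` (`FlexibleEstimate.mono`), which allows one to assume `s < 1 / 4` and `0 ≤ ε < 4 s`.
-/

namespace FlexFRE

open MeasureTheory

/-! ### Signed frequencies -/

lemma sgn_mul_sgn {k : ℕ} (j : Fin (k + 1)) : sgn j * sgn j = 1 := by
  unfold sgn; split_ifs <;> norm_num

lemma abs_sgn {k : ℕ} (j : Fin (k + 1)) : |sgn j| = 1 := by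
  unfold sgn; split_ifs <;> norm_num

lemma sgn_mul_sq {k : ℕ} (j : Fin (k + 1)) (x : ℝ) : (sgn j * x) ^ 2 = x ^ 2 := by
  unfold sgn; split_ifs <;> ring

/-- In the signed variables `sgn j * ζ j` the resonance function treats all frequencies,
ingoing and outgoing, alike. -/
lemma kdvResonance_eq {k : ℕ} (ζ : Fin (k + 1) → ℝ) :
    kdvResonance ζ = -∑ j, (sgn j * ζ j) ^ 3 := by
  simp [kdvResonance, Fin.sum_univ_succ, sgn]
  ring

lemma sum_sgn_of_mem_Gam {k : ℕ} {c σ : ℝ} {ζ : Fin (k + 1) → ℝ} (h : ζ ∈ Gam c σ) :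
    ∑ j, sgn j * ζ j = σ := by
  have := h.1
  simp [Fin.sum_univ_succ, sgn]
  linarith

lemma sum_sgn_slicePoint {k : ℕ} (B : Finset (Fin (k + 1))) (p : Fin (k + 1)) (σ : ℝ)
    (x : Fin (k + 1) → ℝ) (y : ↥(B.erase p) → ℝ) :
    ∑ j, sgn j * slicePoint B p σ x y j = σ := by
  rw [← Finset.add_sum_erase _ _ (Finset.mem_univ p)]
  have h : ∀ j ∈ Finset.univ.erase p, sgn j * slicePoint B p σ x y j
      = sgn j * (if h : j ∈ B.erase p then y ⟨j, h⟩ else x j) := by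
    intro j hj
    rw [slicePoint, Function.update_of_ne (Finset.ne_of_mem_erase hj)]
  rw [Finset.sum_congr rfl h]
  simp only [slicePoint, Function.update_self]
  rw [← mul_assoc, sgn_mul_sgn]
  ring

lemma slicePoint_of_mem {k : ℕ} {B : Finset (Fin (k + 1))} {p j : Fin (k + 1)} (σ : ℝ)
    (x : Fin (k + 1) → ℝ) (y : ↥(B.erase p) → ℝ) (hj : j ∈ B.erase p) :
    slicePoint B p σ x y j = y ⟨j, hj⟩ := by
  rw [slicePoint, Function.update_of_ne (Finset.ne_of_mem_erase hj), dif_pos hj]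

lemma slicePoint_of_notMem {k : ℕ} {B : Finset (Fin (k + 1))} {p j : Fin (k + 1)} (σ : ℝ)
    (x : Fin (k + 1) → ℝ) (y : ↥(B.erase p) → ℝ) (hp : p ∈ B) (hj : j ∉ B) :
    slicePoint B p σ x y j = x j := by
  rw [slicePoint, Function.update_of_ne (by rintro rfl; exact hj hp),
    dif_neg (fun h => hj (Finset.mem_of_mem_erase h))]

/-! ### Slices over three frequencies -/

/-- One half of Tonelli's theorem, valid for arbitrary functions because `∫⁻` is a lower
integral. -/
lemma lintegral_prod_le_lintegral_lintegral {X Y : Type*} [MeasurableSpace X] [MeasurableSpace Y]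
    (μ : Measure X) (ν : Measure Y) [SFinite ν] (f : X × Y → ℝ≥0∞) :
    ∫⁻ z, f z ∂μ.prod ν ≤ ∫⁻ x, ∫⁻ y, f (x, y) ∂ν ∂μ := by
  obtain ⟨g, hg, hgf, h⟩ := exists_measurable_le_lintegral_eq (μ.prod ν) f
  rw [h, lintegral_prod _ hg.aemeasurable]
  exact lintegral_mono fun x => lintegral_mono fun y => hgf _

/-- Integration over a slice in which three frequencies vary is dominated by an iterated
integral: for each value of the frequency `r`, the frequency `q` is integrated with `p`
determined by the hyperplane. -/
lemma sliceIntegral_le_lintegral_lintegral {k : ℕ} (c σ : ℝ) {p q r : Fin (k + 1)} (hpq : p ≠ q)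
    (hpr : p ≠ r) (hqr : q ≠ r) (x : Fin (k + 1) → ℝ) (F : (Fin (k + 1) → ℝ) → ℝ≥0∞) :
    ∃ Z : ℝ → ℝ → Fin (k + 1) → ℝ,
      (∀ v u, Z v u q = u ∧ Z v u r = v ∧ (∀ j ∉ ({p, q, r} : Finset (Fin (k + 1))), Z v u j = x j)
        ∧ ∑ j, sgn j * Z v u j = σ) ∧
      sliceIntegral c {p, q, r} p σ x F ≤ ∫⁻ v, ∫⁻ u, (Gam c σ).indicator F (Z v u) := by
  classical
  set B : Finset (Fin (k + 1)) := {p, q, r} with hB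
  have hq : q ∈ B.erase p := by simp [hB, hpq.symm]
  have hr : r ∈ B.erase p := by simp [hB, hpr.symm]
  have hcases : ∀ j : ↥(B.erase p), j = ⟨r, hr⟩ ∨ j = ⟨q, hq⟩ := by
    rintro ⟨j, hj⟩
    simp only [hB, Finset.mem_erase, Finset.mem_insert, Finset.mem_singleton] at hj
    simp only [Subtype.mk.injEq]
    tauto
  let e : Fin 2 ≃ ↥(B.erase p) := Equiv.ofBijective ![⟨r, hr⟩, ⟨q, hq⟩] (by
    constructor
    · intro a b hab
      fin_cases a <;> fin_cases b <;> simp_all [eq_comm]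
    · intro j
      rcases hcases j with rfl | rfl
      · exact ⟨0, rfl⟩
      · exact ⟨1, rfl⟩)
  let Y : (Fin 2 → ℝ) ≃ᵐ (↥(B.erase p) → ℝ) := MeasurableEquiv.piCongrLeft (fun _ => ℝ) e
  have hY : MeasurePreserving Y volume volume :=
    volume_measurePreserving_piCongrLeft (fun _ => ℝ) e
  have hY2 : MeasurableEmbedding Y := Y.measurableEmbedding
  have hYe : ∀ w i, Y w (e i) = w i := Equiv.piCongrLeft_apply_apply (fun _ => ℝ) e
  have hT := (volume_preserving_finTwoArrow ℝ).symm
  have hT2 := (MeasurableEquiv.finTwoArrow (α := ℝ)).symm.measurableEmbedding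
  let y : ℝ → ℝ → ↥(B.erase p) → ℝ := fun v u => Y ![v, u]
  refine ⟨fun v u => slicePoint B p σ x (y v u), fun v u => ⟨?_, ?_, ?_, ?_⟩, ?_⟩
  · exact (slicePoint_of_mem _ _ _ hq).trans (hYe ![v, u] 1)
  · exact (slicePoint_of_mem _ _ _ hr).trans (hYe ![v, u] 0)
  · exact fun j hj => slicePoint_of_notMem _ _ _ (by simp [hB]) hj
  · exact sum_sgn_slicePoint _ _ _ _ _
  · rw [sliceIntegral, ← hY.lintegral_comp_emb hY2, ← hT.lintegral_comp_emb hT2]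
    exact lintegral_prod_le_lintegral_lintegral _ _ _

/-! ### Sublevel sets of the resonance function on a fibre -/

/-- Two points which differ only in the frequencies `p` and `q`. As `z_p + z_q` is constant,
with `z_j = sgn j * ζ j`, the resonance function is quadratic in `z_q`, with derivative
`3 (z_p² - z_q²)`. -/
lemma mul_abs_sub_le_of_abs_resonance {k : ℕ} {p q : Fin (k + 1)} (hpq : p ≠ q)
    {ζ η : Fin (k + 1) → ℝ} {α M d : ℝ} (h : ∀ j, j ≠ p → j ≠ q → ζ j = η j)
    (hs : ∑ j, sgn j * ζ j = ∑ j, sgn j * η j)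
    (hζ : |kdvResonance ζ - α| < M) (hη : |kdvResonance η - α| < M)
    (hd : d ≤ ζ p ^ 2 - ζ q ^ 2 ∧ d ≤ η p ^ 2 - η q ^ 2 ∨
      d ≤ ζ q ^ 2 - ζ p ^ 2 ∧ d ≤ η q ^ 2 - η p ^ 2) :
    d * |ζ q - η q| ≤ M := by
  have h1 : sgn p * ζ p - sgn p * η p + (sgn q * ζ q - sgn q * η q) = 0 := by
    have hs' := sub_eq_zero.2 hs
    rw [← Finset.sum_sub_distrib] at hs'
    rw [← hs']
    refine (Fintype.sum_eq_add (f := fun j => sgn j * ζ j - sgn j * η j) p q hpq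
      fun j hj => ?_).symm
    simp only [h j hj.1 hj.2, sub_self]
  have h2 : kdvResonance η - kdvResonance ζ = (sgn p * ζ p) ^ 3 - (sgn p * η p) ^ 3
      + ((sgn q * ζ q) ^ 3 - (sgn q * η q) ^ 3) := by
    rw [kdvResonance_eq, kdvResonance_eq, neg_sub_neg, ← Finset.sum_sub_distrib]
    refine Fintype.sum_eq_add p q hpq fun j hj => ?_
    rw [h j hj.1 hj.2, sub_self]
  have h3 : |ζ q - η q| = |sgn q * ζ q - sgn q * η q| := by
    rw [← mul_sub, abs_mul, abs_sgn, one_mul]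
  rw [← sgn_mul_sq p (ζ p), ← sgn_mul_sq q (ζ q), ← sgn_mul_sq p (η p),
    ← sgn_mul_sq q (η q)] at hd
  rw [h3]
  generalize sgn p * ζ p = a at *
  generalize sgn q * ζ q = b at *
  generalize sgn p * η p = a' at *
  generalize sgn q * η q = b' at *
  have h4 : 2 * (kdvResonance η - kdvResonance ζ)
      = 3 * ((b ^ 2 - a ^ 2) + (b' ^ 2 - a' ^ 2)) * (b - b') := by
    rw [h2]
    obtain rfl : a = a' - (b - b') := by linarith
    ring
  have h5 : 3 * |(b ^ 2 - a ^ 2) + (b' ^ 2 - a' ^ 2)| * |b - b'| ≤ 4 * M := by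
    rw [← abs_of_nonneg (show (0 : ℝ) ≤ 3 by norm_num), ← abs_mul, ← abs_mul, ← h4, abs_le]
    rw [abs_lt] at hζ hη
    constructor <;> linarith
  have h6 : 2 * d ≤ |(b ^ 2 - a ^ 2) + (b' ^ 2 - a' ^ 2)| := by
    rcases hd with hd | hd
    · exact le_trans (by linarith) (neg_le_abs _)
    · exact le_trans (by linarith) (le_abs_self _)
  have h7 := mul_le_mul_of_nonneg_right h6 (abs_nonneg (b - b'))
  have h8 : 0 < M := lt_of_le_of_lt (abs_nonneg _) hζ
  nlinarith

lemma volume_le_of_forall_abs_sub_le {T : Set ℝ} {l : ℝ} (h : ∀ x ∈ T, ∀ y ∈ T, |x - y| ≤ l) :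
    volume T ≤ ENNReal.ofReal l := by
  refine (Real.volume_le_diam T).trans (Metric.ediam_le fun x hx y hy => ?_)
  rw [edist_dist, Real.dist_eq]
  exact ENNReal.ofReal_le_ofReal (h x hx y hy)

/-- The interpolation inequality behind the power `M ^ (1 - δ)`. -/
lemma min_le_rpow_mul_rpow {a b δ : ℝ} (ha : 0 < a) (hb : 0 < b) (h0 : 0 ≤ δ) (h1 : δ ≤ 1) :
    min a b ≤ a ^ δ * b ^ (1 - δ) := by
  have hm : 0 < min a b := lt_min ha hb
  calc min a b = min a b ^ δ * min a b ^ (1 - δ) := by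
        rw [← Real.rpow_add hm]; simp
    _ ≤ a ^ δ * b ^ (1 - δ) := by
        have : 0 ≤ 1 - δ := sub_nonneg.2 h1
        gcongr
        · exact min_le_left _ _
        · exact min_le_right _ _

/-- The measure of a sublevel set of the resonance function on a fibre in which only the
frequencies `p` and `q` vary. The derivative is at least `d`, which gives `O(M / d)`, and the
fibre has length `O(L)`; the power `M ^ (1 - δ)` comes from interpolating the two bounds. -/
lemma volume_fiber_le {k : ℕ} {p q : Fin (k + 1)} (hpq : p ≠ q) {Z : ℝ → Fin (k + 1) → ℝ}
    (hZq : ∀ u, Z u q = u) (hZ : ∀ u u' j, j ≠ p → j ≠ q → Z u j = Z u' j)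
    (hs : ∀ u u', ∑ j, sgn j * Z u j = ∑ j, sgn j * Z u' j)
    {α M d L δ : ℝ} (hM : 0 < M) (hd : 0 < d) (hL : 0 < L) (h0 : 0 ≤ δ) (h1 : δ ≤ 1) :
    volume {u | |kdvResonance (Z u) - α| < M ∧ d ≤ |Z u p ^ 2 - Z u q ^ 2| ∧ |u| ≤ L}
      ≤ ENNReal.ofReal (2 * (L ^ δ * (M / d) ^ (1 - δ))) := by
  set T := {u | |kdvResonance (Z u) - α| < M ∧ d ≤ |Z u p ^ 2 - Z u q ^ 2| ∧ |u| ≤ L}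
  have hle : ∀ u u', |kdvResonance (Z u) - α| < M → |kdvResonance (Z u') - α| < M →
      (d ≤ Z u p ^ 2 - Z u q ^ 2 ∧ d ≤ Z u' p ^ 2 - Z u' q ^ 2 ∨
      d ≤ Z u q ^ 2 - Z u p ^ 2 ∧ d ≤ Z u' q ^ 2 - Z u' p ^ 2) → |u - u'| ≤ M / d := by
    intro u u' hu hu' hd'
    have := mul_abs_sub_le_of_abs_resonance hpq (hZ u u') (hs u u') hu hu' hd'
    rw [hZq, hZq] at this
    rwa [le_div_iff₀ hd, mul_comm]
  have hT1 : volume T ≤ ENNReal.ofReal (2 * (M / d)) := by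
    have hsub : T ⊆ {u | u ∈ T ∧ d ≤ Z u p ^ 2 - Z u q ^ 2} ∪
        {u | u ∈ T ∧ d ≤ Z u q ^ 2 - Z u p ^ 2} := by
      intro u hu
      rcases le_abs.1 hu.2.1 with h | h
      · exact Or.inl ⟨hu, h⟩
      · exact Or.inr ⟨hu, by linarith⟩
    refine (measure_mono hsub).trans ((measure_union_le _ _).trans ?_)
    rw [two_mul, ENNReal.ofReal_add (by positivity) (by positivity)]
    refine add_le_add (volume_le_of_forall_abs_sub_le fun u hu u' hu' => ?_)
      (volume_le_of_forall_abs_sub_le fun u hu u' hu' => ?_)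
    · exact hle u u' hu.1.1 hu'.1.1 (Or.inl ⟨hu.2, hu'.2⟩)
    · exact hle u u' hu.1.1 hu'.1.1 (Or.inr ⟨hu.2, hu'.2⟩)
  have hT2 : volume T ≤ ENNReal.ofReal (2 * L) := by
    refine volume_le_of_forall_abs_sub_le fun u hu u' hu' => ?_
    have := abs_sub u u'
    have := hu.2.2
    have := hu'.2.2
    linarith
  refine (le_min hT2 hT1).trans ?_
  rw [← ENNReal.ofReal_min]
  refine ENNReal.ofReal_le_ofReal ?_
  rw [← mul_min_of_nonneg _ _ zero_le_two]
  exact mul_le_mul_of_nonneg_left (min_le_rpow_mul_rpow hL (by positivity) h0 h1) zero_le_two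

/-! ### A singular kernel -/

lemma lintegral_Icc_abs_rpow_le {L θ : ℝ} (hL : 0 < L) (hθ : θ < 1) :
    ∫⁻ t in Set.Icc (-L) L, ENNReal.ofReal (|t| ^ (-θ))
      ≤ ENNReal.ofReal (2 / (1 - θ) * L ^ (1 - θ)) := by
  have hpos : ∫⁻ t in Set.Ioc 0 L, ENNReal.ofReal (|t| ^ (-θ))
      = ENNReal.ofReal (1 / (1 - θ) * L ^ (1 - θ)) := by
    have hint : IntervalIntegrable (fun t : ℝ => t ^ (-θ)) volume 0 L :=
      intervalIntegral.intervalIntegrable_rpow' (by linarith)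
    rw [intervalIntegrable_iff_integrableOn_Ioc_of_le hL.le] at hint
    have h1 : ∫⁻ t in Set.Ioc 0 L, ENNReal.ofReal (|t| ^ (-θ))
        = ∫⁻ t in Set.Ioc 0 L, ENNReal.ofReal (t ^ (-θ)) :=
      setLIntegral_congr_fun measurableSet_Ioc fun t ht => by
        simp only [abs_of_pos ht.1]
    rw [h1, ← ofReal_integral_eq_lintegral_ofReal hint
      ((ae_restrict_iff' measurableSet_Ioc).2 (ae_of_all _ fun t ht =>
        Real.rpow_nonneg ht.1.le _)), ← intervalIntegral.integral_of_le hL.le,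
      integral_rpow (Or.inl (by linarith))]
    congr 1
    rw [Real.zero_rpow (by linarith), neg_add_eq_sub]
    ring
  have hneg : ∫⁻ t in Set.Ico (-L) 0, ENNReal.ofReal (|t| ^ (-θ))
      = ∫⁻ t in Set.Ioc 0 L, ENNReal.ofReal (|t| ^ (-θ)) := by
    have h := (Measure.measurePreserving_neg (volume : Measure ℝ)).setLIntegral_comp_preimage_emb
      (MeasurableEquiv.neg ℝ).measurableEmbedding
      (fun t => ENNReal.ofReal (|t| ^ (-θ))) (Set.Ioc 0 L)
    rw [← h]
    simp
  have hsub : Set.Icc (-L) L ⊆ (Set.Ico (-L) 0 ∪ Set.Ioc 0 L) ∪ {0} := by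
    intro t ht
    rcases lt_trichotomy t 0 with h | h | h
    · exact Or.inl (Or.inl ⟨ht.1, h⟩)
    · exact Or.inr h
    · exact Or.inl (Or.inr ⟨h, ht.2⟩)
  refine (lintegral_mono_set hsub).trans ((lintegral_union_le _ _ _).trans ?_)
  rw [Measure.restrict_singleton]
  simp only [Real.volume_singleton, zero_smul, lintegral_zero_measure, add_zero]
  refine (lintegral_union_le _ _ _).trans ?_
  have : 0 < 1 - θ := by linarith
  rw [hneg, hpos, ← ENNReal.ofReal_add (by positivity) (by positivity)]
  refine ENNReal.ofReal_le_ofReal (le_of_eq ?_)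
  ring

lemma lintegral_Icc_abs_sub_rpow_le {L θ : ℝ} (v₀ : ℝ) (hL : 0 < L) (h0 : 0 ≤ θ) (hθ : θ < 1) :
    ∫⁻ v in Set.Icc (-L) L, ENNReal.ofReal (|v - v₀| ^ (-θ))
      ≤ ENNReal.ofReal ((2 / (1 - θ) + 2) * L ^ (1 - θ)) := by
  have hθ' : 0 < 1 - θ := by linarith
  have hpt : ∀ v, ENNReal.ofReal (|v - v₀| ^ (-θ)) ≤
      (Set.Icc (-L) L).indicator (fun t => ENNReal.ofReal (|t| ^ (-θ))) (v - v₀)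
        + ENNReal.ofReal (L ^ (-θ)) := by
    intro v
    by_cases hv : v - v₀ ∈ Set.Icc (-L) L
    · rw [Set.indicator_of_mem hv]
      exact le_self_add
    · rw [Set.indicator_of_notMem hv, zero_add]
      refine ENNReal.ofReal_le_ofReal (Real.rpow_le_rpow_of_nonpos hL ?_ (by linarith))
      by_contra! h
      exact hv (abs_le.1 h.le)
  calc _ ≤ ∫⁻ v in Set.Icc (-L) L, ((Set.Icc (-L) L).indicator
          (fun t => ENNReal.ofReal (|t| ^ (-θ))) (v - v₀) + ENNReal.ofReal (L ^ (-θ))) :=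
        lintegral_mono hpt
    _ = (∫⁻ v in Set.Icc (-L) L, (Set.Icc (-L) L).indicator
          (fun t => ENNReal.ofReal (|t| ^ (-θ))) (v - v₀))
          + ENNReal.ofReal (L ^ (-θ)) * volume (Set.Icc (-L) L) := by
        rw [lintegral_add_right _ measurable_const, setLIntegral_const]
    _ ≤ ENNReal.ofReal (2 / (1 - θ) * L ^ (1 - θ)) + ENNReal.ofReal (2 * L ^ (1 - θ)) := by
        gcongr
        · refine (setLIntegral_le_lintegral _ _).trans ?_
          rw [lintegral_sub_right_eq_self
            (fun t => (Set.Icc (-L) L).indicator (fun t => ENNReal.ofReal (|t| ^ (-θ))) t) v₀,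
            lintegral_indicator measurableSet_Icc]
          exact lintegral_Icc_abs_rpow_le hL hθ
        · rw [Real.volume_Icc, ← ENNReal.ofReal_mul (by positivity)]
          refine ENNReal.ofReal_le_ofReal (le_of_eq ?_)
          rw [sub_eq_add_neg 1 θ, Real.rpow_add hL, Real.rpow_one]
          ring
    _ = _ := by
        rw [← ENNReal.ofReal_add (by positivity) (by positivity), add_mul]

/-! ### Frequency-restricted estimates from pointwise bounds -/

lemma indicator_indicator_le {X : Type*} {S T : Set X} {f : X → ℝ≥0∞} {ζ : X} {t : ℝ≥0∞}
    (h : ζ ∈ S → ζ ∈ T → f ζ ≤ t) : S.indicator (T.indicator f) ζ ≤ t := by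
  classical
  rw [Set.indicator_apply, Set.indicator_apply]
  split_ifs with h1 h2
  exacts [h h1 h2, zero_le, zero_le]

/-- A frequency-restricted estimate over three frequencies, from bounds that on each fibre
`ζ r = v` control the weight by `w v` and the derivative of the resonance function from below by
`d v`. -/
lemma restrictedEstimate_of_fiber_bounds {k : ℕ} {c : ℝ} {W : (Fin (k + 1) → ℝ) → ℝ}
    {R : Set (Fin (k + 1) → ℝ)} {p q r : Fin (k + 1)} (hpq : p ≠ q) (hpr : p ≠ r) (hqr : q ≠ r)
    {C δ θ : ℝ} (hC : 0 < C) (hδ : 0 < δ) (hδ' : δ ≤ 1) (hθ : 0 ≤ θ) (hθ' : θ < 1)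
    (h : ∀ (σ : ℝ) (x : Fin (k + 1) → ℝ), ∃ L > (0 : ℝ), ∃ (v₀ : ℝ) (w d : ℝ → ℝ),
      (∀ v, v ≠ v₀ → 0 ≤ w v ∧ 0 < d v ∧
        w v * (L ^ δ / d v ^ (1 - δ)) ≤ C * (L ^ (θ - 1) * |v - v₀| ^ (-θ))) ∧
      ∀ ζ ∈ Gam c σ ∩ R, (∀ j ∉ ({p, q, r} : Finset (Fin (k + 1))), ζ j = x j) →
        ‖ζ‖ ≤ L ∧ (ζ r ≠ v₀ → W ζ ≤ w (ζ r) ∧ d (ζ r) ≤ |ζ p ^ 2 - ζ q ^ 2|)) :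
    RestrictedEstimate c kdvResonance W R {p, q, r} := by
  have hθ1 : 0 < 1 - θ := by linarith
  refine ⟨p, by simp, 2 * C * (2 / (1 - θ) + 2), by positivity, δ, hδ, fun M hM σ α x => ?_⟩
  obtain ⟨L, hL, v₀, w, d, hwd, hζ⟩ := h σ x
  obtain ⟨Z, hZ, hle⟩ := sliceIntegral_le_lintegral_lintegral c σ hpq hpr hqr x
    ((R ∩ {ζ | |kdvResonance ζ - α| < M}).indicator fun ζ => ENNReal.ofReal (W ζ))
  refine hle.trans ?_
  set K : ℝ := 2 * C * M ^ (1 - δ) * L ^ (θ - 1) with hK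
  have hM0 : 0 < M := by linarith
  have hfib : ∀ v, v ≠ v₀ → ∫⁻ u, (Gam c σ).indicator
      ((R ∩ {ζ | |kdvResonance ζ - α| < M}).indicator fun ζ => ENNReal.ofReal (W ζ)) (Z v u)
      ≤ (Set.Icc (-L) L).indicator
        (fun v => ENNReal.ofReal K * ENNReal.ofReal (|v - v₀| ^ (-θ))) v := by
    intro v hv
    obtain ⟨hw, hd, hwd⟩ := hwd v hv
    set T := {u | |kdvResonance (Z v u) - α| < M ∧ d v ≤ |Z v u p ^ 2 - Z v u q ^ 2| ∧ |u| ≤ L}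
    have hpt : ∀ u, (Gam c σ).indicator
        ((R ∩ {ζ | |kdvResonance ζ - α| < M}).indicator fun ζ => ENNReal.ofReal (W ζ)) (Z v u)
        ≤ (Set.Icc (-L) L).indicator
          (fun _ => T.indicator (fun _ => ENNReal.ofReal (w v)) u) v := by
      intro u
      refine indicator_indicator_le fun h1 ⟨h2, h3⟩ => ?_
      obtain ⟨hn, hb⟩ := hζ (Z v u) ⟨h1, h2⟩ (hZ v u).2.2.1
      have hr := (hZ v u).2.1
      have hq := (hZ v u).1
      rw [hr] at hb
      obtain ⟨hb1, hb2⟩ := hb hv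
      have hvL : |v| ≤ L := by
        rw [← hr]; exact (norm_le_pi_norm (Z v u) r).trans hn
      have huL : |u| ≤ L := by
        conv_lhs => rw [← hq]
        exact (norm_le_pi_norm (Z v u) q).trans hn
      have huT : u ∈ T := ⟨h3, hb2, huL⟩
      rw [Set.indicator_of_mem (Set.mem_Icc.2 (abs_le.1 hvL)), Set.indicator_of_mem huT]
      exact ENNReal.ofReal_le_ofReal hb1
    refine (lintegral_mono hpt).trans ?_
    by_cases hvL : v ∈ Set.Icc (-L) L
    · simp only [Set.indicator_of_mem hvL]
      refine (lintegral_indicator_const_le _ _).trans ?_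
      have hT : volume T ≤ ENNReal.ofReal (2 * (L ^ δ * (M / d v) ^ (1 - δ))) := by
        refine volume_fiber_le hpq (fun u => (hZ v u).1) (fun u u' j hp hq => ?_)
          (fun u u' => by rw [(hZ v u).2.2.2, (hZ v u').2.2.2]) hM0 hd hL hδ.le hδ'
        by_cases hjr : j = r
        · rw [hjr, (hZ v u).2.1, (hZ v u').2.1]
        · have hj : j ∉ ({p, q, r} : Finset (Fin (k + 1))) := by simp [hp, hq, hjr]
          rw [(hZ v u).2.2.1 j hj, (hZ v u').2.2.1 j hj]
      refine (mul_le_mul_right hT _).trans ?_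
      rw [← ENNReal.ofReal_mul hw, ← ENNReal.ofReal_mul (by positivity)]
      refine ENNReal.ofReal_le_ofReal ?_
      rw [Real.div_rpow hM0.le hd.le]
      calc w v * (2 * (L ^ δ * (M ^ (1 - δ) / d v ^ (1 - δ))))
          = 2 * M ^ (1 - δ) * (w v * (L ^ δ / d v ^ (1 - δ))) := by ring
        _ ≤ 2 * M ^ (1 - δ) * (C * (L ^ (θ - 1) * |v - v₀| ^ (-θ))) := by gcongr
        _ = K * |v - v₀| ^ (-θ) := by rw [hK]; ring
    · simp [Set.indicator_of_notMem hvL]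
  calc ∫⁻ v, ∫⁻ u, (Gam c σ).indicator
          ((R ∩ {ζ | |kdvResonance ζ - α| < M}).indicator fun ζ => ENNReal.ofReal (W ζ)) (Z v u)
      ≤ ∫⁻ v, (Set.Icc (-L) L).indicator
        (fun v => ENNReal.ofReal K * ENNReal.ofReal (|v - v₀| ^ (-θ))) v := by
        -- the bound on the fibre fails at `v = v₀`, where `0 ^ (-θ)` is not infinite
        refine lintegral_mono_ae ?_
        filter_upwards [(Set.countable_singleton v₀).ae_notMem volume] with v hv
        exact hfib v hv
    _ = ENNReal.ofReal K * ∫⁻ v in Set.Icc (-L) L, ENNReal.ofReal (|v - v₀| ^ (-θ)) := by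
        rw [lintegral_indicator measurableSet_Icc, lintegral_const_mul' _ _ ENNReal.ofReal_ne_top]
    _ ≤ ENNReal.ofReal K * ENNReal.ofReal ((2 / (1 - θ) + 2) * L ^ (1 - θ)) :=
        mul_le_mul_right (lintegral_Icc_abs_sub_rpow_le v₀ hL hθ hθ') _
    _ = ENNReal.ofReal (2 * C * (2 / (1 - θ) + 2) * M ^ (1 - δ)) := by
        rw [← ENNReal.ofReal_mul (by positivity)]
        congr 1
        have : L ^ (θ - 1) * L ^ (1 - θ) = 1 := by
          rw [← Real.rpow_add hL]; simp
        rw [hK]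
        linear_combination (2 * C * M ^ (1 - δ) * (2 / (1 - θ) + 2)) * this

/-- A frequency-restricted estimate over the frequencies `p`, `q`, `r`, when a frozen frequency
is comparable to `‖ζ‖`. The frequency `r` is measured by its distance `D` to the fraction `l`
of the conserved sum `z_p + z_q + z_r`, `z_j = sgn j * ζ j`; the weight may be singular like
`D ^ (-τ)` and the derivative `ζ p ^ 2 - ζ q ^ 2` may degenerate like `D ^ β`. -/
lemma restrictedEstimate_of_weight_le {k : ℕ} {c : ℝ} {W : (Fin (k + 1) → ℝ) → ℝ}
    {R : Set (Fin (k + 1) → ℝ)} {p q r : Fin (k + 1)} (hpq : p ≠ q) (hpr : p ≠ r) (hqr : q ≠ r)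
    {κ C a l τ β δ : ℝ} (hκ : 0 < κ) (hC : 0 < C)
    (ha : 0 ≤ a) (hτ : 0 ≤ τ) (hβ : 0 ≤ β) (hβ' : β ≤ 2) (hδ : 0 < δ) (hδ' : δ ≤ 1)
    (hδa : a + 3 * δ = 1 + τ) (hθ : τ + β * (1 - δ) < 1)
    (h : ∀ σ, ∀ ζ ∈ Gam c σ ∩ R, 1 ≤ ‖ζ‖ ∧
      (∃ f ∉ ({p, q, r} : Finset (Fin (k + 1))), κ * ‖ζ‖ ≤ |ζ f|) ∧
      W ζ * |sgn r * ζ r - l * (sgn p * ζ p + sgn q * ζ q + sgn r * ζ r)| ^ τ ≤ C * ‖ζ‖ ^ a ∧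
      κ * (‖ζ‖ ^ (2 - β) *
        |sgn r * ζ r - l * (sgn p * ζ p + sgn q * ζ q + sgn r * ζ r)| ^ β)
        ≤ |ζ p ^ 2 - ζ q ^ 2|) :
    RestrictedEstimate c kdvResonance W R {p, q, r} := by
  have hδ1 : 0 ≤ 1 - δ := sub_nonneg.2 hδ'
  set Q : ℝ := (κ * κ ^ (2 - β)) ^ (1 - δ)
  have hQ : 0 < Q := by positivity
  refine restrictedEstimate_of_fiber_bounds hpq hpr hqr (C := C / Q) (by positivity)
    hδ hδ' (θ := τ + β * (1 - δ)) (by positivity) hθ fun σ x => ?_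
  set S : ℝ := σ - ∑ j ∈ ({p, q, r} : Finset (Fin (k + 1)))ᶜ, sgn j * x j with hS
  -- `F` is the size of the frozen frequencies; it controls `‖ζ‖` from both sides on the slice
  set F : ℝ := ‖fun j => if j ∈ ({p, q, r} : Finset (Fin (k + 1))) then 0 else x j‖ with hF
  set L : ℝ := max 1 (F / κ) with hL
  have hL0 : 0 < L := lt_max_of_lt_left one_pos
  refine ⟨L, hL0, sgn r * (l * S), fun v => C * L ^ a * |v - sgn r * (l * S)| ^ (-τ),
    fun v => κ * ((κ * L) ^ (2 - β) * |v - sgn r * (l * S)| ^ β), fun v hv => ?_,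
    fun ζ hζ hx => ?_⟩
  · have hX : 0 < |v - sgn r * (l * S)| := abs_pos.2 (sub_ne_zero.2 hv)
    beta_reduce
    set X := |v - sgn r * (l * S)|
    refine ⟨by positivity, by positivity, le_of_eq ?_⟩
    have e1 : (κ * ((κ * L) ^ (2 - β) * X ^ β)) ^ (1 - δ)
        = Q * (L ^ ((2 - β) * (1 - δ)) * X ^ (β * (1 - δ))) := by
      have : κ * ((κ * L) ^ (2 - β) * X ^ β) = κ * κ ^ (2 - β) * (L ^ (2 - β) * X ^ β) := by
        rw [Real.mul_rpow hκ.le hL0.le]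
        ring
      rw [this, Real.mul_rpow (x := κ * κ ^ (2 - β)) (by positivity) (by positivity),
        Real.mul_rpow (x := L ^ (2 - β)) (by positivity) (by positivity), ← Real.rpow_mul hL0.le,
        ← Real.rpow_mul hX.le]
    have e2 : L ^ (τ + β * (1 - δ) - 1) * L ^ ((2 - β) * (1 - δ)) = L ^ a * L ^ δ := by
      rw [← Real.rpow_add hL0, ← Real.rpow_add hL0]
      congr 1
      linear_combination -hδa
    have e3 : X ^ (-(τ + β * (1 - δ))) * X ^ (β * (1 - δ)) = X ^ (-τ) := by
      rw [← Real.rpow_add hX]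
      congr 1
      ring
    have p1 : 0 < L ^ ((2 - β) * (1 - δ)) := by positivity
    have p2 : 0 < X ^ (β * (1 - δ)) := by positivity
    rw [e1]
    field_simp
    linear_combination X ^ (-τ) * (-e2) - L ^ (τ + β * (1 - δ) - 1) * L ^ ((2 - β) * (1 - δ)) * e3
  · obtain ⟨h1, ⟨f, hf, h2⟩, h3, h4⟩ := h σ ζ hζ
    have hSζ : sgn p * ζ p + sgn q * ζ q + sgn r * ζ r = S := by
      have e1 := sum_sgn_of_mem_Gam hζ.1
      rw [← Finset.sum_add_sum_compl ({p, q, r} : Finset (Fin (k + 1)))] at e1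
      have e2 : ∑ j ∈ ({p, q, r} : Finset (Fin (k + 1)))ᶜ, sgn j * ζ j
          = ∑ j ∈ ({p, q, r} : Finset (Fin (k + 1)))ᶜ, sgn j * x j :=
        Finset.sum_congr rfl fun j hj => by rw [hx j (Finset.mem_compl.1 hj)]
      rw [e2, Finset.sum_insert (by simp [hpq, hpr]), Finset.sum_insert (by simp [hqr]),
        Finset.sum_singleton] at e1
      rw [hS, ← e1]
      ring
    have hdist : |sgn r * ζ r - l * (sgn p * ζ p + sgn q * ζ q + sgn r * ζ r)|
        = |ζ r - sgn r * (l * S)| := by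
      have := sgn_mul_sgn r
      have e : sgn r * ζ r - l * S = sgn r * (ζ r - sgn r * (l * S)) := by
        linear_combination (l * S) * this
      rw [hSζ, e, abs_mul, abs_sgn, one_mul]
    have hN : ‖ζ‖ ≤ F / κ := by
      rw [le_div_iff₀ hκ, mul_comm]
      refine h2.trans ?_
      have := norm_le_pi_norm
        (fun j => if j ∈ ({p, q, r} : Finset (Fin (k + 1))) then 0 else x j) f
      simpa only [if_neg hf, Real.norm_eq_abs, ← hx f hf] using this
    have hNL : ‖ζ‖ ≤ L := hN.trans (le_max_right _ _)
    have hLN : κ * L ≤ ‖ζ‖ := by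
      rw [hL, max_eq_right (h1.trans hN), mul_div_cancel₀ _ hκ.ne', hF,
        pi_norm_le_iff_of_nonneg (norm_nonneg _)]
      intro j
      split_ifs with hj
      · simp
      · rw [← hx j hj]
        exact norm_le_pi_norm ζ j
    refine ⟨hNL, fun hr => ?_⟩
    rw [hdist] at h3 h4
    have hX : 0 < |ζ r - sgn r * (l * S)| := abs_pos.2 (sub_ne_zero.2 hr)
    have : 0 ≤ 2 - β := sub_nonneg.2 hβ'
    beta_reduce
    constructor
    · rw [Real.rpow_neg hX.le, ← div_eq_mul_inv, le_div_iff₀ (by positivity)]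
      exact h3.trans (by gcongr)
    · refine le_trans ?_ h4
      gcongr

lemma restrictedEstimate_of_bounded {k : ℕ} {c : ℝ} {Φ W : (Fin (k + 1) → ℝ) → ℝ}
    {R : Set (Fin (k + 1) → ℝ)} {p q r : Fin (k + 1)} (hpq : p ≠ q) (hpr : p ≠ r) (hqr : q ≠ r)
    {C : ℝ} (hC : 0 < C) (h : ∀ σ, ∀ ζ ∈ Gam c σ ∩ R, ‖ζ‖ ≤ 1 ∧ W ζ ≤ C) :
    RestrictedEstimate c Φ W R {p, q, r} := by
  refine ⟨p, by simp, C * 4, by positivity, 1, one_pos, fun M _ σ α x => ?_⟩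
  obtain ⟨Z, hZ, hle⟩ := sliceIntegral_le_lintegral_lintegral c σ hpq hpr hqr x
    ((R ∩ {ζ | |Φ ζ - α| < M}).indicator fun ζ => ENNReal.ofReal (W ζ))
  refine hle.trans ?_
  have hpt : ∀ v u, (Gam c σ).indicator
      ((R ∩ {ζ | |Φ ζ - α| < M}).indicator fun ζ => ENNReal.ofReal (W ζ)) (Z v u)
      ≤ (Set.Icc (-1) 1).indicator (fun _ => (Set.Icc (-1) 1).indicator
        (fun _ => ENNReal.ofReal C) u) v := by
    intro v u
    refine indicator_indicator_le fun h1 ⟨h2, h3⟩ => ?_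
    obtain ⟨hn, hb⟩ := h σ (Z v u) ⟨h1, h2⟩
    have hv : |Z v u r| ≤ 1 := (norm_le_pi_norm (Z v u) r).trans hn
    have hu : |Z v u q| ≤ 1 := (norm_le_pi_norm (Z v u) q).trans hn
    rw [(hZ v u).2.1] at hv
    rw [(hZ v u).1] at hu
    rw [Set.indicator_of_mem (Set.mem_Icc.2 (abs_le.1 hv)),
      Set.indicator_of_mem (Set.mem_Icc.2 (abs_le.1 hu))]
    exact ENNReal.ofReal_le_ofReal hb
  refine (lintegral_mono fun v => lintegral_mono (hpt v)).trans (le_of_eq ?_)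
  have e1 : ∀ v, ∫⁻ u, (Set.Icc (-1 : ℝ) 1).indicator (fun _ => (Set.Icc (-1 : ℝ) 1).indicator
        (fun _ => ENNReal.ofReal C) u) v
      = (Set.Icc (-1 : ℝ) 1).indicator (fun _ => ENNReal.ofReal (C * 2)) v := by
    intro v
    by_cases hv : v ∈ Set.Icc (-1 : ℝ) 1
    · simp only [Set.indicator_of_mem hv]
      rw [lintegral_indicator measurableSet_Icc, setLIntegral_const, Real.volume_Icc,
        ← ENNReal.ofReal_mul hC.le]
      norm_num
    · simp [Set.indicator_of_notMem hv]
  rw [lintegral_congr e1, lintegral_indicator measurableSet_Icc, setLIntegral_const,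
    Real.volume_Icc, ← ENNReal.ofReal_mul (by positivity)]
  congr 1
  simp only [sub_self, Real.rpow_zero]
  ring

lemma RestrictedEstimate.mono {k : ℕ} {c K : ℝ} {Φ W W' : (Fin (k + 1) → ℝ) → ℝ}
    {R R' : Set (Fin (k + 1) → ℝ)} {B : Finset (Fin (k + 1))} (hK : 0 < K)
    (h : RestrictedEstimate c Φ W R B) (hR : R' ⊆ R)
    (hW : ∀ σ, ∀ ζ ∈ Gam c σ, W' ζ ≤ K * W ζ) :
    RestrictedEstimate c Φ W' R' B := by
  obtain ⟨p, hp, C, hC, δ, hδ, h⟩ := h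
  refine ⟨p, hp, K * C, by positivity, δ, hδ, fun M hM σ α x => ?_⟩
  calc sliceIntegral c B p σ x
        ((R' ∩ {ζ | |Φ ζ - α| < M}).indicator fun ζ => ENNReal.ofReal (W' ζ))
      ≤ ENNReal.ofReal K * sliceIntegral c B p σ x
        ((R ∩ {ζ | |Φ ζ - α| < M}).indicator fun ζ => ENNReal.ofReal (W ζ)) := by
        rw [sliceIntegral, sliceIntegral, ← lintegral_const_mul' _ _ ENNReal.ofReal_ne_top]
        refine lintegral_mono fun y => ?_
        generalize slicePoint B p σ x y = ζ
        refine indicator_indicator_le fun h1 ⟨h2, h3⟩ => ?_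
        have h4 : ζ ∈ R ∩ {ζ | |Φ ζ - α| < M} := ⟨hR h2, h3⟩
        rw [Set.indicator_of_mem h1, Set.indicator_of_mem h4, ← ENNReal.ofReal_mul hK.le]
        exact ENNReal.ofReal_le_ofReal (hW σ ζ h1)
    _ ≤ ENNReal.ofReal K * ENNReal.ofReal (C * M ^ (1 - δ)) := mul_le_mul_right (h M hM σ α x) _
    _ = ENNReal.ofReal (K * C * M ^ (1 - δ)) := by
        rw [← ENNReal.ofReal_mul hK.le, mul_assoc]

/-! ### Finite coverings -/

/-- `S` is covered by finitely many measurable sets, each with property `P`. -/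
def FinCov {X : Type*} [MeasurableSpace X] (P : Set X → Prop) (S : Set X) : Prop :=
  ∃ 𝓡 : Set (Set X), 𝓡.Finite ∧ (∀ R ∈ 𝓡, MeasurableSet R ∧ P R) ∧ S ⊆ ⋃₀ 𝓡

namespace FinCov

variable {X : Type*} [MeasurableSpace X] {P Q : Set X → Prop} {S T : Set X}

lemma of_measurableSet (hS : MeasurableSet S) (h : P S) : FinCov P S :=
  ⟨{S}, Set.finite_singleton S, by simp [hS, h], by simp⟩

lemma mono (h : FinCov P T) (hS : S ⊆ T) (hPQ : ∀ R, P R → Q R) : FinCov Q S := by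
  obtain ⟨𝓡, hf, hP, hT⟩ := h
  exact ⟨𝓡, hf, fun R hR => ⟨(hP R hR).1, hPQ R (hP R hR).2⟩, hS.trans hT⟩

lemma iUnion {ι : Type*} [Finite ι] {S : ι → Set X} (h : ∀ i, FinCov P (S i)) :
    FinCov P (⋃ i, S i) := by
  choose 𝓡 hf hP hS using h
  refine ⟨⋃ i, 𝓡 i, Set.finite_iUnion hf, fun R hR => ?_, Set.iUnion_subset fun i => ?_⟩
  · obtain ⟨i, hi⟩ := Set.mem_iUnion.1 hR
    exact hP i R hi
  · exact (hS i).trans (Set.sUnion_subset_sUnion (Set.subset_iUnion 𝓡 i))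

lemma union (hS : FinCov P S) (hT : FinCov P T) : FinCov P (S ∪ T) := by
  rw [Set.union_eq_iUnion]
  exact iUnion fun b => by cases b <;> assumption

lemma and (hP : FinCov P S) (hQ : FinCov Q S) (hP' : ∀ R R', R' ⊆ R → P R → P R')
    (hQ' : ∀ R R', R' ⊆ R → Q R → Q R') : FinCov (fun R => P R ∧ Q R) S := by
  obtain ⟨𝓡, hf, h, hS⟩ := hP
  obtain ⟨𝓡', hf', h', hS'⟩ := hQ
  refine ⟨Set.image2 (· ∩ ·) 𝓡 𝓡', hf.image2 _ hf', ?_, fun x hx => ?_⟩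
  · rintro _ ⟨R, hR, R', hR', rfl⟩
    exact ⟨(h R hR).1.inter (h' R' hR').1, hP' _ _ Set.inter_subset_left (h R hR).2,
      hQ' _ _ Set.inter_subset_right (h' R' hR').2⟩
  · obtain ⟨R, hR, hxR⟩ := hS hx
    obtain ⟨R', hR', hxR'⟩ := hS' hx
    exact ⟨R ∩ R', ⟨R, hR, R', hR', rfl⟩, hxR, hxR'⟩

end FinCov

/-! ### Bounds for the weight -/

lemma one_le_jap (x : ℝ) : 1 ≤ jap x := by
  rw [jap, Real.one_le_sqrt]; nlinarith [sq_nonneg x]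

lemma jap_pos (x : ℝ) : 0 < jap x := one_pos.trans_le (one_le_jap x)

lemma abs_le_jap (x : ℝ) : |x| ≤ jap x :=
  Real.abs_le_sqrt (by linarith)

lemma jap_le (x : ℝ) : jap x ≤ 1 + |x| := by
  rw [jap, Real.sqrt_le_left (by positivity)]
  nlinarith [sq_abs x, abs_nonneg x]

/-- The exponents which are `s` for the outgoing frequency and `av i` for the ingoing frequency
`π i`. -/
def exps (s : ℝ) {k : ℕ} (π : Equiv.Perm (Fin k)) (av : Fin k → ℝ) : Fin (k + 1) → ℝ :=
  Fin.cons s (av ∘ π.symm)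

lemma exps_add_exps {s : ℝ} {k : ℕ} (π : Equiv.Perm (Fin k)) {av av' : Fin k → ℝ}
    (h : ∀ i, av i + av' i = 2 * s) (j : Fin (k + 1)) :
    exps s π av j + exps s π av' j = 2 * s := by
  refine Fin.cases ?_ (fun i => ?_) j
  · simp [exps, two_mul]
  · simpa [exps] using h _

lemma weight_exps_mul_prod_le {s ε : ℝ} {k : ℕ} (π : Equiv.Perm (Fin k)) {av bv : Fin k → ℝ}
    {ζ : Fin (k + 1) → ℝ} (hs : 0 ≤ s + ε) (ha : ∀ i, 0 ≤ av i) (hb : ∀ i, 0 ≤ bv i)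
    (hbv : ∀ i, bv i ≤ jap (ζ (π i).succ)) :
    weight kdvMultiplier (exps s π av) ε ζ * ∏ i, bv i ^ av i
      ≤ ‖ζ‖ * (1 + ‖ζ‖) ^ (s + ε) := by
  have h0 : |ζ 0| ≤ ‖ζ‖ := norm_le_pi_norm ζ 0
  have hprod : ∏ j : Fin k, jap (ζ j.succ) ^ (exps s π av j.succ)
      = ∏ i, jap (ζ (π i).succ) ^ av i := by
    rw [← Equiv.prod_comp π]
    simp [exps]
  have hpos : 0 < ∏ i, jap (ζ (π i).succ) ^ av i :=
    Finset.prod_pos fun i _ => Real.rpow_pos_of_pos (jap_pos _) _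
  have hle : ∏ i, bv i ^ av i ≤ ∏ i, jap (ζ (π i).succ) ^ av i :=
    Finset.prod_le_prod (fun i _ => Real.rpow_nonneg (hb i) _)
      fun i _ => Real.rpow_le_rpow (hb i) (hbv i) (ha i)
  have hnum : |kdvMultiplier ζ| * jap (ζ 0) ^ (exps s π av 0 + ε)
      ≤ ‖ζ‖ * (1 + ‖ζ‖) ^ (s + ε) := by
    simp only [kdvMultiplier, exps, Fin.cons_zero]
    have := jap_pos (ζ 0)
    have : jap (ζ 0) ≤ 1 + ‖ζ‖ := (jap_le _).trans (by linarith)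
    gcongr
  have hnum0 : 0 ≤ |kdvMultiplier ζ| * jap (ζ 0) ^ (exps s π av 0 + ε) := by
    have := jap_pos (ζ 0)
    positivity
  rw [weight, hprod, div_mul_eq_mul_div, div_le_iff₀ hpos]
  exact mul_le_mul hnum hle (Finset.prod_nonneg fun i _ => Real.rpow_nonneg (hb i) _)
    (hnum0.trans hnum)

/-- If the ingoing frequencies comparable to `‖ζ‖` carry the total exponent `t`, they
compensate the factor `‖ζ‖ ^ t`. -/
lemma weight_exps_mul_le {s ε κ t P : ℝ} {k : ℕ} (π : Equiv.Perm (Fin k)) {av bv : Fin k → ℝ}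
    {ζ : Fin (k + 1) → ℝ} (hs : 0 ≤ s + ε) (hκ : 0 < κ) (hN : 1 ≤ ‖ζ‖) (ha : ∀ i, 0 ≤ av i)
    (hb : ∀ i, 0 ≤ bv i) (hbv : ∀ i, bv i ≤ jap (ζ (π i).succ))
    (hP : ∏ i, bv i ^ av i = P * (κ * ‖ζ‖) ^ t) :
    weight kdvMultiplier (exps s π av) ε ζ * P
      ≤ 2 ^ (s + ε) / κ ^ t * ‖ζ‖ ^ (1 + s + ε - t) := by
  have h := weight_exps_mul_prod_le π hs ha hb hbv
  have hN0 : 0 < ‖ζ‖ := by linarith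
  rw [hP, Real.mul_rpow hκ.le hN0.le] at h
  have h2 : ‖ζ‖ * (1 + ‖ζ‖) ^ (s + ε) ≤ 2 ^ (s + ε) * ‖ζ‖ ^ (1 + s + ε) := by
    calc ‖ζ‖ * (1 + ‖ζ‖) ^ (s + ε) ≤ ‖ζ‖ * (2 * ‖ζ‖) ^ (s + ε) := by
          gcongr
          linarith
      _ = 2 ^ (s + ε) * ‖ζ‖ ^ (1 + s + ε) := by
          rw [Real.mul_rpow zero_le_two hN0.le, add_assoc 1 s ε, Real.rpow_add hN0 1, Real.rpow_one]
          ring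
  have hκt : 0 < κ ^ t := Real.rpow_pos_of_pos hκ t
  have hNt : 0 < ‖ζ‖ ^ t := Real.rpow_pos_of_pos hN0 t
  rw [Real.rpow_sub hN0, div_mul_div_comm, le_div_iff₀ (by positivity)]
  calc _ = weight kdvMultiplier (exps s π av) ε ζ * (P * (κ ^ t * ‖ζ‖ ^ t)) := by ring
    _ ≤ _ := h.trans h2

/-! ### Nonstationary and stationary triples -/

/-- Where the derivative `ζ p ^ 2 - ζ q ^ 2` has the maximal size `‖ζ‖ ^ 2`, the remaining
frequency `r` is integrated against the integrable singularity `|ζ r| ^ (-4 * s)`. -/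
lemma restrictedEstimate_of_nonstationary {k : ℕ} {c s ε κ C : ℝ} {W : (Fin (k + 1) → ℝ) → ℝ}
    {R : Set (Fin (k + 1) → ℝ)} {p q r : Fin (k + 1)} (hpq : p ≠ q) (hpr : p ≠ r) (hqr : q ≠ r)
    (hs : 0 < s) (hs' : s < 1 / 4) (hε : 0 ≤ ε) (hεs : ε < 4 * s) (hκ : 0 < κ) (hC : 0 < C)
    (h : ∀ ζ ∈ R, 1 ≤ ‖ζ‖ ∧ (∃ f ∉ ({p, q, r} : Finset (Fin (k + 1))), κ * ‖ζ‖ ≤ |ζ f|) ∧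
      W ζ * |ζ r| ^ (4 * s) ≤ C * ‖ζ‖ ^ (1 + ε) ∧ κ * ‖ζ‖ ^ 2 ≤ |ζ p ^ 2 - ζ q ^ 2|) :
    RestrictedEstimate c kdvResonance W R {p, q, r} := by
  refine restrictedEstimate_of_weight_le hpq hpr hqr (κ := κ) (C := C) (a := 1 + ε) (l := 0)
    (τ := 4 * s) (β := 0) (δ := (4 * s - ε) / 3) hκ hC (by linarith) (by linarith) le_rfl
    zero_le_two (by linarith) (by linarith) (by ring) (by linarith) fun σ ζ hζ => ?_
  obtain ⟨h1, h2, h3, h4⟩ := h ζ hζ.2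
  refine ⟨h1, h2, ?_, ?_⟩
  · rwa [zero_mul, sub_zero, abs_mul, abs_sgn, one_mul]
  · simpa using h4

/-- The derivative `z_p² - z_q²`, `z_j = sgn j * ζ j`, vanishes if `z_p + z_q = 0`, that is if `z_r`
equals the conserved sum `z_p + z_q + z_r`, or if `z_p = z_q`. In the second alternative
`|z_p - z_q|` controls the distance of `z_r` to a third of that sum. -/
lemma finCov_stationary_of_pair {k : ℕ} {c s ε κ C : ℝ} {W : (Fin (k + 1) → ℝ) → ℝ}
    {S : Set (Fin (k + 1) → ℝ)} {p q r : Fin (k + 1)} (hpq : p ≠ q) (hpr : p ≠ r) (hqr : q ≠ r)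
    (hs' : s < 1 / 4) (hε : 0 ≤ ε) (hεs : ε < 4 * s) (hκ : 0 < κ) (hC : 0 < C)
    (hS : MeasurableSet S)
    (h : ∀ ζ ∈ S, 1 ≤ ‖ζ‖ ∧ (∃ f ∉ ({p, q, r} : Finset (Fin (k + 1))), κ * ‖ζ‖ ≤ |ζ f|) ∧
      W ζ ≤ C * ‖ζ‖ ^ (1 + ε - 4 * s)) :
    FinCov (fun R => RestrictedEstimate c kdvResonance W R {p, q, r})
      (S ∩ ({ζ | κ * ‖ζ‖ ≤ |sgn p * ζ p - sgn q * ζ q|} ∪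
        {ζ | κ * ‖ζ‖ ≤ |sgn p * ζ p + sgn q * ζ q| ∧
          |2 * (sgn r * ζ r) - sgn p * ζ p - sgn q * ζ q|
            ≤ 2 * |sgn p * ζ p - sgn q * ζ q|})) := by
  have key : ∀ (l : ℝ) (R : Set (Fin (k + 1) → ℝ)), R ⊆ S →
      (∀ ζ ∈ R, κ * (‖ζ‖ * |sgn r * ζ r - l * (sgn p * ζ p + sgn q * ζ q + sgn r * ζ r)|)
        ≤ |(sgn p * ζ p) ^ 2 - (sgn q * ζ q) ^ 2|) →
      RestrictedEstimate c kdvResonance W R {p, q, r} := by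
    intro l R hRS hR
    refine restrictedEstimate_of_weight_le hpq hpr hqr (κ := κ) (C := C) (a := 1 + ε - 4 * s)
      (l := l) (τ := 0) (β := 1) (δ := (4 * s - ε) / 3) hκ hC (by linarith) le_rfl
      zero_le_one one_le_two (by linarith) (by linarith) (by ring) (by linarith) fun σ ζ hζ => ?_
    obtain ⟨h1, h2, h3⟩ := h ζ (hRS hζ.2)
    have h4 := hR ζ hζ.2
    rw [sgn_mul_sq, sgn_mul_sq] at h4
    refine ⟨h1, h2, by rwa [Real.rpow_zero, mul_one], ?_⟩
    rw [Real.rpow_one]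
    norm_num
    exact h4
  rw [Set.inter_union_distrib_left]
  refine FinCov.union (FinCov.of_measurableSet ?_ ?_) (FinCov.of_measurableSet ?_ ?_)
  · exact hS.inter (measurableSet_le (by fun_prop) (by fun_prop))
  · refine key 1 _ Set.inter_subset_left ?_
    rintro ζ ⟨-, h1⟩
    rw [Set.mem_ofPred_eq] at h1
    rw [sq_sub_sq, abs_mul, mul_comm |_ + _|, ← mul_assoc]
    refine mul_le_mul h1 (le_of_eq ?_) (abs_nonneg _) (abs_nonneg _)
    rw [← abs_neg]
    congr 1
    ring
  · exact hS.inter (by measurability)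
  · refine key (1 / 3) _ Set.inter_subset_left ?_
    rintro ζ ⟨-, h1, h2⟩
    rw [sq_sub_sq, abs_mul, ← mul_assoc]
    refine mul_le_mul h1 ?_ (abs_nonneg _) (abs_nonneg _)
    have e : 2 * (sgn r * ζ r) - sgn p * ζ p - sgn q * ζ q
        = 3 * (sgn r * ζ r - 1 / 3 * (sgn p * ζ p + sgn q * ζ q + sgn r * ζ r)) := by ring
    rw [e, abs_mul, abs_of_pos (by norm_num : (0 : ℝ) < 3)] at h2
    linarith [abs_nonneg (sgn p * ζ p - sgn q * ζ q)]

/-- Three numbers, one of which is large: for the pair `u`, `v` with the largest difference, either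
that difference is large, or all three numbers nearly agree and `u + v` is large. -/
lemma exists_pair_of_large {x y z m κ : ℝ} (h : 2 * (κ * m) ≤ |x| ∨ 2 * (κ * m) ≤ |y| ∨
    2 * (κ * m) ≤ |z|) :
    (κ * m ≤ |x - y| ∨ κ * m ≤ |x + y| ∧ |2 * z - x - y| ≤ 2 * |x - y|) ∨
    (κ * m ≤ |y - z| ∨ κ * m ≤ |y + z| ∧ |2 * x - y - z| ≤ 2 * |y - z|) ∨
    (κ * m ≤ |z - x| ∨ κ * m ≤ |z + x| ∧ |2 * y - z - x| ≤ 2 * |z - x|) := by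
  generalize κ * m = t at *
  by_contra! hcon
  obtain ⟨⟨h1, h1'⟩, ⟨h2, h2'⟩, ⟨h3, h3'⟩⟩ := hcon
  have aux : ∀ a b c : ℝ, |a - b| < t → |b - c| < t → |c - a| < t →
      (2 * t ≤ |a| ∨ 2 * t ≤ |b| ∨ 2 * t ≤ |c|) → t ≤ |a + b| := by
    intro a b c hab hbc hca habc
    rw [abs_lt] at hab hbc hca
    simp only [le_abs] at habc ⊢
    rcases habc with (h | h) | (h | h) | (h | h)
    all_goals first | (left; linarith) | (right; linarith)
  have f1 := h1' (aux x y z h1 h2 h3 h)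
  have f2 := h2' (aux y z x h2 h3 h1 (by tauto))
  have f3 := h3' (aux z x y h3 h1 h2 (by tauto))
  have g1 : |2 * z - x - y| ≤ |z - x| + |y - z| := by
    rw [show 2 * z - x - y = (z - x) - (y - z) by ring]; exact abs_sub _ _
  have g2 : |2 * x - y - z| ≤ |x - y| + |z - x| := by
    rw [show 2 * x - y - z = (x - y) - (z - x) by ring]; exact abs_sub _ _
  have g3 : |2 * y - z - x| ≤ |y - z| + |x - y| := by
    rw [show 2 * y - z - x = (y - z) - (x - y) by ring]; exact abs_sub _ _
  linarith

/-- Over a triple containing a frequency comparable to `‖ζ‖` the estimate holds with a loss-free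
weight `‖ζ‖ ^ (1 - (4 * s - ε))`, whether or not the resonance function is stationary there. -/
lemma finCov_stationary {k : ℕ} {c s ε κ C : ℝ} {W : (Fin (k + 1) → ℝ) → ℝ}
    {S : Set (Fin (k + 1) → ℝ)} {p q r : Fin (k + 1)} (hpq : p ≠ q) (hpr : p ≠ r) (hqr : q ≠ r)
    (hs' : s < 1 / 4) (hε : 0 ≤ ε) (hεs : ε < 4 * s) (hκ : 0 < κ) (hC : 0 < C)
    (hS : MeasurableSet S)
    (h : ∀ ζ ∈ S, 1 ≤ ‖ζ‖ ∧ (∃ f ∉ ({p, q, r} : Finset (Fin (k + 1))), κ * ‖ζ‖ ≤ |ζ f|) ∧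
      (∃ g ∈ ({p, q, r} : Finset (Fin (k + 1))), κ * ‖ζ‖ ≤ |ζ g|) ∧
      W ζ ≤ C * ‖ζ‖ ^ (1 + ε - 4 * s)) :
    FinCov (fun R => RestrictedEstimate c kdvResonance W R {p, q, r}) S := by
  have e1 : ({q, r, p} : Finset (Fin (k + 1))) = {p, q, r} := by
    ext; simp only [Finset.mem_insert, Finset.mem_singleton]; tauto
  have e2 : ({r, p, q} : Finset (Fin (k + 1))) = {p, q, r} := by
    ext; simp only [Finset.mem_insert, Finset.mem_singleton]; tauto
  have h' : ∀ ζ ∈ S, 1 ≤ ‖ζ‖ ∧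
      (∃ f ∉ ({p, q, r} : Finset (Fin (k + 1))), κ / 2 * ‖ζ‖ ≤ |ζ f|) ∧
      W ζ ≤ C * ‖ζ‖ ^ (1 + ε - 4 * s) := by
    intro ζ hζ
    obtain ⟨h1, ⟨f, hf, h2⟩, h3, h4⟩ := h ζ hζ
    have := mul_nonneg hκ.le (norm_nonneg ζ)
    exact ⟨h1, ⟨f, hf, by linarith⟩, h4⟩
  have c1 := finCov_stationary_of_pair (c := c) hpq hpr hqr hs' hε hεs (half_pos hκ) hC hS h'
  have c2 := finCov_stationary_of_pair (c := c) hqr hpq.symm hpr.symm hs' hε hεs (half_pos hκ) hC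
    hS (by rwa [e1])
  have c3 := finCov_stationary_of_pair (c := c) hpr.symm hqr.symm hpq hs' hε hεs (half_pos hκ) hC
    hS (by rwa [e2])
  rw [e1] at c2
  rw [e2] at c3
  refine (c1.union (c2.union c3)).mono (fun ζ hζ => ?_) fun R hR => hR
  obtain ⟨-, -, ⟨g, hg, h3⟩, -⟩ := h ζ hζ
  have hlarge : 2 * (κ / 2 * ‖ζ‖) ≤ |sgn p * ζ p| ∨ 2 * (κ / 2 * ‖ζ‖) ≤ |sgn q * ζ q| ∨
      2 * (κ / 2 * ‖ζ‖) ≤ |sgn r * ζ r| := by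
    simp only [abs_mul, abs_sgn, one_mul]
    rw [show 2 * (κ / 2 * ‖ζ‖) = κ * ‖ζ‖ by ring]
    simp only [Finset.mem_insert, Finset.mem_singleton] at hg
    rcases hg with rfl | rfl | rfl
    exacts [Or.inl h3, Or.inr (Or.inl h3), Or.inr (Or.inr h3)]
  rcases exists_pair_of_large hlarge with hc | hc | hc
  · exact Or.inl ⟨hζ, hc⟩
  · exact Or.inr (Or.inl ⟨hζ, hc⟩)
  · exact Or.inr (Or.inr ⟨hζ, hc⟩)

/-! ### Frequency regions -/

/-- The property required of each region in `FlexibleEstimate`. -/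
def HasFlexibleSplit {k : ℕ} (c : ℝ) (m Φ : (Fin (k + 1) → ℝ) → ℝ) (s ε : ℝ)
    (R : Set (Fin (k + 1) → ℝ)) : Prop :=
  ∃ A : Finset (Fin (k + 1)), A.Nonempty ∧ A ≠ Finset.univ ∧
    ∃ (a a' : Fin (k + 1) → ℝ) (e e' : ℝ),
      (∀ j, a j + a' j = 2 * s) ∧ e + e' = 2 * ε ∧
      RestrictedEstimate c Φ (weight m a e) R Aᶜ ∧ RestrictedEstimate c Φ (weight m a' e') R A

lemma flexibleEstimate_of_finCov {k : ℕ} {m Φ : (Fin (k + 1) → ℝ) → ℝ} {s ε : ℝ}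
    (h : ∀ c > 0, FinCov (HasFlexibleSplit c m Φ s ε) Set.univ) : FlexibleEstimate m Φ s ε := by
  intro c hc
  obtain ⟨𝓡, hf, hR, hcov⟩ := h c hc
  have := hf.fintype
  let e := (Fintype.equivFin 𝓡).symm
  refine ⟨Fintype.card 𝓡, fun i => (e i : Set _), fun i => (hR _ (e i).2).1, ?_,
    fun i => (hR _ (e i).2).2⟩
  rw [e.surjective.iUnion_comp (fun R : 𝓡 => (R : Set (Fin (k + 1) → ℝ))), ← Set.sUnion_eq_iUnion]
  exact Set.univ_subset_iff.1 hcov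

/-- A splitting of the frequencies into the triples `B` and `B'`, where each of the two estimates
may need its own finite subdivision of the region. -/
lemma finCov_hasFlexibleSplit {c s ε : ℝ} {S : Set (Fin 6 → ℝ)} (π : Equiv.Perm (Fin 5))
    {av av' : Fin 5 → ℝ} {B B' : Finset (Fin 6)} (hB : B'ᶜ = B) (hne : B.Nonempty)
    (hne' : B'.Nonempty) (hav : ∀ i, av i + av' i = 2 * s)
    (h : FinCov (fun R => RestrictedEstimate c kdvResonance
      (weight kdvMultiplier (exps s π av) ε) R B) S)
    (h' : FinCov (fun R => RestrictedEstimate c kdvResonance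
      (weight kdvMultiplier (exps s π av') ε) R B') S) :
    FinCov (HasFlexibleSplit c kdvMultiplier kdvResonance s ε) S := by
  have hmono : ∀ (W : (Fin 6 → ℝ) → ℝ) (B : Finset (Fin 6)) (R R' : Set (Fin 6 → ℝ)), R' ⊆ R →
      RestrictedEstimate c kdvResonance W R B → RestrictedEstimate c kdvResonance W R' B :=
    fun W B R R' hR h => h.mono one_pos hR fun _ ζ _ => (one_mul (W ζ)).ge
  refine (h.and h' (hmono _ _) (hmono _ _)).mono subset_rfl ?_
  rintro R ⟨hR, hR'⟩
  refine ⟨B', hne', ?_, exps s π av, exps s π av', ε, ε, exps_add_exps π hav, (two_mul ε).symm,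
    by rwa [hB], hR'⟩
  rintro rfl
  simp at hB
  simp [← hB] at hne

/-- The splitting of the frequencies with outgoing frequency in the first triple. -/
lemma compl_outgoing_triple (π : Equiv.Perm (Fin 5)) {a b c d e : Fin 5}
    (h : ∀ i, i = a ∨ i = b ∨ i = c ∨ i = d ∨ i = e) (hac : c ≠ a) (had : d ≠ a) (hae : e ≠ a)
    (hbc : c ≠ b) (hbd : d ≠ b) (hbe : e ≠ b) :
    ({(π c).succ, (π d).succ, (π e).succ} : Finset (Fin 6))ᶜ = {0, (π a).succ, (π b).succ} := by
  ext j
  refine Fin.cases ?_ (fun j => ?_) j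
  · simp [(Fin.succ_ne_zero _).symm]
  · obtain ⟨i, rfl⟩ := π.surjective j
    simp only [Finset.mem_compl, Finset.mem_insert, Finset.mem_singleton, Fin.succ_inj,
      EmbeddingLike.apply_eq_iff_eq, Fin.succ_ne_zero, false_or]
    rcases h i with rfl | rfl | rfl | rfl | rfl <;> tauto

/-- If the difference of two squares is comparable to `m ^ 2`, one of the numbers is comparable
to `m`. -/
lemma large_of_sq_sub_sq {κ m x y : ℝ} (hκ : 0 < κ) (hκ' : κ ≤ 1)
    (h : κ * m ^ 2 ≤ |x ^ 2 - y ^ 2|) : κ * m ≤ |x| ∨ κ * m ≤ |y| := by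
  by_contra! hcon
  obtain ⟨hx, hy⟩ := hcon
  have hx2 : x ^ 2 < (κ * m) ^ 2 := by rw [← sq_abs x]; gcongr
  have hy2 : y ^ 2 < (κ * m) ^ 2 := by rw [← sq_abs y]; gcongr
  have h1 : |x ^ 2 - y ^ 2| < (κ * m) ^ 2 := by
    rw [abs_lt]; constructor <;> nlinarith [sq_nonneg x, sq_nonneg y]
  have h2 : (κ * m) ^ 2 ≤ κ * m ^ 2 := by
    have : κ * κ ≤ κ * 1 := by gcongr
    nlinarith [sq_nonneg m]
  linarith

lemma abs_rpow_mul_self {x s : ℝ} (hs : 0 < s) :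
    |x| ^ (2 * s) * |x| ^ (2 * s) = |x| ^ (4 * s) := by
  rw [← Real.rpow_add_of_nonneg (abs_nonneg x) (by positivity) (by positivity)]
  ring_nf

/-- All ingoing frequencies are comparable to `‖ζ‖`. -/
def regionLarge (κ : ℝ) : Set (Fin 6 → ℝ) := {ζ | 1 ≤ ‖ζ‖ ∧ ∀ j : Fin 5, κ * ‖ζ‖ ≤ |ζ j.succ|}

/-- The ingoing frequencies other than `π 0`, `π 1` are comparable to `‖ζ‖`, and the resonance
function is nonstationary between the frequency `p` and the ingoing frequency `π 0`. -/
def regionMixed (κ : ℝ) (π : Equiv.Perm (Fin 5)) (p : Fin 6) : Set (Fin 6 → ℝ) :=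
  {ζ | 1 ≤ ‖ζ‖ ∧ κ * ‖ζ‖ ≤ |ζ (π 2).succ| ∧ κ * ‖ζ‖ ≤ |ζ (π 3).succ| ∧
    κ * ‖ζ‖ ≤ |ζ (π 4).succ| ∧ κ * ‖ζ‖ ^ 2 ≤ |ζ p ^ 2 - ζ (π 0).succ ^ 2| ∧
    |ζ (π 1).succ| ≤ |ζ (π 0).succ|}

/-- The ingoing frequency `π 0` is comparable to `‖ζ‖`, and the resonance function is nonstationary
both between the outgoing frequency and `π 1` and between `π 0` and `π 3`. -/
def regionNonstationary (κ : ℝ) (π : Equiv.Perm (Fin 5)) : Set (Fin 6 → ℝ) :=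
  {ζ | 1 ≤ ‖ζ‖ ∧ κ * ‖ζ‖ ≤ |ζ (π 0).succ| ∧ κ * ‖ζ‖ ^ 2 ≤ |ζ 0 ^ 2 - ζ (π 1).succ ^ 2| ∧
    κ * ‖ζ‖ ^ 2 ≤ |ζ (π 0).succ ^ 2 - ζ (π 3).succ ^ 2| ∧
    |ζ (π 2).succ| ≤ |ζ (π 1).succ| ∧ |ζ (π 4).succ| ≤ |ζ (π 3).succ|}

lemma finCov_regionLarge {c s ε κ : ℝ} (hs : 0 < s) (hs' : s < 1 / 4) (hε : 0 ≤ ε)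
    (hεs : ε < 4 * s) (hκ : 0 < κ) :
    FinCov (HasFlexibleSplit c kdvMultiplier kdvResonance s ε) (regionLarge κ) := by
  have hS : MeasurableSet (regionLarge κ) := by unfold regionLarge; measurability
  have hW : ∀ ζ ∈ regionLarge κ, weight kdvMultiplier (exps s 1 fun _ : Fin 5 => s) ε ζ
      ≤ 2 ^ (s + ε) / κ ^ (5 * s) * ‖ζ‖ ^ (1 + ε - 4 * s) := by
    rintro ζ ⟨h1, h2⟩
    have h := weight_exps_mul_le (P := 1) (t := 5 * s) (ε := ε) (av := fun _ : Fin 5 => s)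
      (bv := fun _ => κ * ‖ζ‖) 1 (by positivity) hκ h1 (fun _ => hs.le) (fun _ => by positivity)
      (fun i => (h2 _).trans (abs_le_jap _)) (by
        rw [Finset.prod_const, Finset.card_univ, Fintype.card_fin, one_mul, mul_comm 5 s,
          ← Real.rpow_natCast, ← Real.rpow_mul (by positivity)]
        norm_num)
    rw [mul_one] at h
    convert h using 3
    ring
  refine finCov_hasFlexibleSplit 1 (av := fun _ => s) (av' := fun _ => s)
    (compl_outgoing_triple 1 (a := 0) (b := 1) (c := 2) (d := 3) (e := 4)
      (by decide) (by decide) (by decide) (by decide) (by decide) (by decide) (by decide))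
    (by simp) (by simp) (fun i => (two_mul s).symm) ?_ ?_
  · refine finCov_stationary (κ := κ) (by decide) (by decide) (by decide) hs' hε hεs hκ
      (C := 2 ^ (s + ε) / κ ^ (5 * s)) (by positivity) hS fun ζ hζ => ?_
    exact ⟨hζ.1, ⟨3, by decide, hζ.2 2⟩, ⟨1, by decide, hζ.2 0⟩, hW ζ hζ⟩
  · refine finCov_stationary (κ := κ) (by decide) (by decide) (by decide) hs' hε hεs hκ
      (C := 2 ^ (s + ε) / κ ^ (5 * s)) (by positivity) hS fun ζ hζ => ?_
    exact ⟨hζ.1, ⟨1, by decide, hζ.2 0⟩, ⟨3, by decide, hζ.2 2⟩, hW ζ hζ⟩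

lemma succ_apply_ne {k : ℕ} (π : Equiv.Perm (Fin k)) {i j : Fin k} (h : i ≠ j) :
    (π i).succ ≠ (π j).succ := by
  simpa using h

/-- The triple with `p` is nonstationary; it carries the full weight of the possibly small frequencies
`π 0` and `π 1`, whose product of weights is at most `|ζ (π 1).succ| ^ (-4 * s)`. The weight on the
complementary triple then involves large frequencies only. -/
lemma finCov_regionMixed_of_compl {c s ε κ : ℝ} (hs : 0 < s) (hs' : s < 1 / 4) (hε : 0 ≤ ε)
    (hεs : ε < 4 * s) (hκ : 0 < κ) (hκ' : κ ≤ 1) (π : Equiv.Perm (Fin 5)) {p p' : Fin 6}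
    (hB : ({p', (π 3).succ, (π 4).succ} : Finset (Fin 6))ᶜ = {p, (π 0).succ, (π 1).succ})
    (hp0 : p ≠ (π 0).succ) (hp1 : p ≠ (π 1).succ) (hp3 : p' ≠ (π 3).succ)
    (hp4 : p' ≠ (π 4).succ) :
    FinCov (HasFlexibleSplit c kdvMultiplier kdvResonance s ε) (regionMixed κ π p) := by
  have hS : MeasurableSet (regionMixed κ π p) := by unfold regionMixed; measurability
  have hmem : ∀ j ∈ ({p, (π 0).succ, (π 1).succ} : Finset (Fin 6)),
      j ∉ ({p', (π 3).succ, (π 4).succ} : Finset (Fin 6)) := fun j hj => by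
    rwa [← hB, Finset.mem_compl] at hj
  have hmem' : ∀ j ∈ ({p', (π 3).succ, (π 4).succ} : Finset (Fin 6)),
      j ∉ ({p, (π 0).succ, (π 1).succ} : Finset (Fin 6)) := fun j hj => by
    rwa [← hB, Finset.notMem_compl]
  have hb : ∀ ζ ∈ regionMixed κ π p, ∀ i : Fin 5,
      0 ≤ ![|ζ (π 1).succ|, |ζ (π 1).succ|, κ * ‖ζ‖, κ * ‖ζ‖, κ * ‖ζ‖] i ∧
      ![|ζ (π 1).succ|, |ζ (π 1).succ|, κ * ‖ζ‖, κ * ‖ζ‖, κ * ‖ζ‖] i ≤ jap (ζ (π i).succ) := by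
    rintro ζ ⟨h1, h2, h3, h4, -, h5⟩ i
    have := abs_nonneg (ζ (π 1).succ)
    have : 0 ≤ κ * ‖ζ‖ := by positivity
    fin_cases i
    · exact ⟨abs_nonneg _, h5.trans (abs_le_jap _)⟩
    · exact ⟨abs_nonneg _, abs_le_jap _⟩
    · exact ⟨this, h2.trans (abs_le_jap _)⟩
    · exact ⟨this, h3.trans (abs_le_jap _)⟩
    · exact ⟨this, h4.trans (abs_le_jap _)⟩
  refine finCov_hasFlexibleSplit π (av := ![2 * s, 2 * s, s / 3, s / 3, s / 3])
    (av' := ![0, 0, 5 * s / 3, 5 * s / 3, 5 * s / 3]) hB (by simp) (by simp)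
    (fun i => by fin_cases i <;> simp <;> ring) ?_ ?_
  · refine FinCov.of_measurableSet hS (restrictedEstimate_of_nonstationary (κ := κ)
      (C := 2 ^ (s + ε) / κ ^ s) hp0 hp1 (succ_apply_ne π (by decide)) hs hs' hε hεs hκ
      (by positivity) fun ζ hζ => ?_)
    have hκN : 0 < κ * ‖ζ‖ := by have := hζ.1; positivity
    refine ⟨hζ.1, ⟨(π 3).succ, hmem' _ (by simp), hζ.2.2.1⟩, ?_, hζ.2.2.2.2.1⟩
    have h := weight_exps_mul_le (P := |ζ (π 1).succ| ^ (4 * s)) (t := s) (ε := ε)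
      (av := ![2 * s, 2 * s, s / 3, s / 3, s / 3])
      (bv := ![|ζ (π 1).succ|, |ζ (π 1).succ|, κ * ‖ζ‖, κ * ‖ζ‖, κ * ‖ζ‖]) π (by positivity) hκ
      hζ.1 (fun i => by fin_cases i <;> simp <;> positivity) (fun i => (hb ζ hζ i).1)
      (fun i => (hb ζ hζ i).2) (by
        simp only [Fin.prod_univ_five]
        simp only [Matrix.cons_val]
        rw [abs_rpow_mul_self hs, mul_assoc, mul_assoc, ← Real.rpow_add hκN, ← Real.rpow_add hκN]
        ring_nf)
    convert h using 3
    ring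
  · refine finCov_stationary (κ := κ) (C := 2 ^ (s + ε) / κ ^ (5 * s)) hp3 hp4
      (succ_apply_ne π (by decide)) hs' hε hεs hκ (by positivity) hS fun ζ hζ => ?_
    have hκN : 0 < κ * ‖ζ‖ := by have := hζ.1; positivity
    refine ⟨hζ.1, ?_, ⟨(π 3).succ, by simp, hζ.2.2.1⟩, ?_⟩
    · rcases large_of_sq_sub_sq hκ hκ' hζ.2.2.2.2.1 with h | h
      · exact ⟨p, hmem _ (by simp), h⟩
      · exact ⟨(π 0).succ, hmem _ (by simp), h⟩
    have h := weight_exps_mul_le (P := 1) (t := 5 * s) (ε := ε)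
      (av := ![0, 0, 5 * s / 3, 5 * s / 3, 5 * s / 3])
      (bv := ![|ζ (π 1).succ|, |ζ (π 1).succ|, κ * ‖ζ‖, κ * ‖ζ‖, κ * ‖ζ‖]) π (by positivity) hκ
      hζ.1 (fun i => by fin_cases i <;> simp <;> positivity) (fun i => (hb ζ hζ i).1)
      (fun i => (hb ζ hζ i).2) (by
        simp only [Fin.prod_univ_five]
        simp only [Matrix.cons_val]
        rw [Real.rpow_zero, one_mul, one_mul, one_mul, ← Real.rpow_add hκN, ← Real.rpow_add hκN]
        ring_nf)
    rw [mul_one] at h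
    convert h using 3
    ring

lemma finCov_regionMixed_outgoing {c s ε κ : ℝ} (hs : 0 < s) (hs' : s < 1 / 4) (hε : 0 ≤ ε)
    (hεs : ε < 4 * s) (hκ : 0 < κ) (hκ' : κ ≤ 1) (π : Equiv.Perm (Fin 5)) :
    FinCov (HasFlexibleSplit c kdvMultiplier kdvResonance s ε) (regionMixed κ π 0) :=
  finCov_regionMixed_of_compl hs hs' hε hεs hκ hκ' π
    (compl_outgoing_triple π (a := 0) (b := 1) (c := 2) (d := 3) (e := 4)
      (by decide) (by decide) (by decide) (by decide) (by decide) (by decide) (by decide))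
    (Fin.succ_ne_zero _).symm (Fin.succ_ne_zero _).symm (succ_apply_ne π (by decide))
    (succ_apply_ne π (by decide))

lemma finCov_regionMixed_ingoing {c s ε κ : ℝ} (hs : 0 < s) (hs' : s < 1 / 4) (hε : 0 ≤ ε)
    (hεs : ε < 4 * s) (hκ : 0 < κ) (hκ' : κ ≤ 1) (π : Equiv.Perm (Fin 5)) :
    FinCov (HasFlexibleSplit c kdvMultiplier kdvResonance s ε)
      (regionMixed κ π (π 2).succ) :=
  finCov_regionMixed_of_compl hs hs' hε hεs hκ hκ' π (p' := 0)
    (by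
      rw [← compl_outgoing_triple π (a := 3) (b := 4) (c := 2) (d := 0) (e := 1)
        (by decide) (by decide) (by decide) (by decide) (by decide) (by decide) (by decide),
        compl_compl])
    (succ_apply_ne π (by decide)) (succ_apply_ne π (by decide))
    (Fin.succ_ne_zero _).symm (Fin.succ_ne_zero _).symm

/-- Each triple carries the full weight of its own two possibly small ingoing frequencies, `π 1` and
`π 2`, respectively `π 3` and `π 4`; the weight of `π 0` is shared. -/
lemma finCov_regionNonstationary {c s ε κ : ℝ} (hs : 0 < s) (hs' : s < 1 / 4) (hε : 0 ≤ ε)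
    (hεs : ε < 4 * s) (hκ : 0 < κ) (hκ' : κ ≤ 1) (π : Equiv.Perm (Fin 5)) :
    FinCov (HasFlexibleSplit c kdvMultiplier kdvResonance s ε) (regionNonstationary κ π) := by
  have hS : MeasurableSet (regionNonstationary κ π) := by
    unfold regionNonstationary; measurability
  refine finCov_hasFlexibleSplit π (av := ![s, 2 * s, 2 * s, 0, 0])
    (av' := ![s, 0, 0, 2 * s, 2 * s])
    (compl_outgoing_triple π (a := 1) (b := 2) (c := 0) (d := 3) (e := 4)
      (by decide) (by decide) (by decide) (by decide) (by decide) (by decide) (by decide))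
    (by simp) (by simp) (fun i => by (fin_cases i <;> simp); ring) ?_ ?_
  · refine FinCov.of_measurableSet hS (restrictedEstimate_of_nonstationary (κ := κ)
      (C := 2 ^ (s + ε) / κ ^ s) (Fin.succ_ne_zero _).symm (Fin.succ_ne_zero _).symm
      (succ_apply_ne π (by decide)) hs hs' hε hεs hκ (by positivity) fun ζ hζ => ?_)
    obtain ⟨h1, h2, h3, h4, h5, h6⟩ := hζ
    have hκN : 0 ≤ κ * ‖ζ‖ := by positivity
    refine ⟨h1, ⟨(π 0).succ, by simp, h2⟩, ?_, h3⟩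
    have h := weight_exps_mul_le (P := |ζ (π 2).succ| ^ (4 * s)) (t := s) (ε := ε)
      (av := ![s, 2 * s, 2 * s, 0, 0])
      (bv := ![κ * ‖ζ‖, |ζ (π 2).succ|, |ζ (π 2).succ|, 1, 1]) π (by positivity) hκ
      h1 (fun i => by fin_cases i <;> simp <;> positivity)
      (fun i => by (fin_cases i <;> simp); positivity)
      (fun i => by
        fin_cases i
        exacts [h2.trans (abs_le_jap _), h5.trans (abs_le_jap _), abs_le_jap _, one_le_jap _,
          one_le_jap _]) (by
        simp only [Fin.prod_univ_five]
        simp only [Matrix.cons_val]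
        rw [Real.rpow_zero, ← abs_rpow_mul_self hs]
        ring)
    convert h using 3
    ring
  · refine FinCov.of_measurableSet hS (restrictedEstimate_of_nonstationary (κ := κ)
      (C := 2 ^ (s + ε) / κ ^ s) (succ_apply_ne π (by decide)) (succ_apply_ne π (by decide))
      (succ_apply_ne π (by decide)) hs hs' hε hεs hκ (by positivity) fun ζ hζ => ?_)
    obtain ⟨h1, h2, h3, h4, h5, h6⟩ := hζ
    have hκN : 0 ≤ κ * ‖ζ‖ := by positivity
    refine ⟨h1, ?_, ?_, h4⟩
    · rcases large_of_sq_sub_sq hκ hκ' h3 with h | h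
      · exact ⟨0, by simp [(Fin.succ_ne_zero _).symm], h⟩
      · exact ⟨(π 1).succ, by simp, h⟩
    have h := weight_exps_mul_le (P := |ζ (π 4).succ| ^ (4 * s)) (t := s) (ε := ε)
      (av := ![s, 0, 0, 2 * s, 2 * s])
      (bv := ![κ * ‖ζ‖, 1, 1, |ζ (π 4).succ|, |ζ (π 4).succ|]) π (by positivity) hκ
      h1 (fun i => by fin_cases i <;> simp <;> positivity)
      (fun i => by (fin_cases i <;> simp); positivity)
      (fun i => by
        fin_cases i
        exacts [h2.trans (abs_le_jap _), one_le_jap _, one_le_jap _, h6.trans (abs_le_jap _),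
          abs_le_jap _]) (by
        simp only [Fin.prod_univ_five]
        simp only [Matrix.cons_val]
        rw [Real.rpow_zero, ← abs_rpow_mul_self hs]
        ring)
    convert h using 3
    ring

/-- Frequency vectors of norm less than `1`, together with those which do not lie in any `Gam c σ`. -/
def regionTrivial (c : ℝ) : Set (Fin 6 → ℝ) :=
  {ζ | 1 ≤ ‖ζ‖ ∧ ∀ j : Fin 5, |∑ i, sgn i * ζ i| ≤ c * |ζ j.succ|}ᶜ

lemma finCov_regionTrivial {c s ε : ℝ} (hs : 0 < s) (hε : 0 ≤ ε) :
    FinCov (HasFlexibleSplit c kdvMultiplier kdvResonance s ε) (regionTrivial c) := by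
  have hS : MeasurableSet (regionTrivial c) := by unfold regionTrivial; measurability
  have hW : ∀ σ, ∀ ζ ∈ Gam c σ ∩ regionTrivial c,
      ‖ζ‖ ≤ 1 ∧ weight kdvMultiplier (exps s 1 fun _ : Fin 5 => s) ε ζ ≤ 2 ^ (s + ε) := by
    rintro σ ζ ⟨h1, h2⟩
    have hN : ‖ζ‖ ≤ 1 := by
      by_contra! hcon
      refine h2 ⟨hcon.le, fun j => ?_⟩
      rw [sum_sgn_of_mem_Gam h1]
      exact h1.2 j
    refine ⟨hN, ?_⟩
    have h := weight_exps_mul_prod_le (ε := ε) (s := s) (av := fun _ : Fin 5 => s)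
      (bv := fun _ => 1) (ζ := ζ) 1 (by positivity) (fun _ => hs.le) (fun _ => zero_le_one)
      (fun i => one_le_jap _)
    simp only [Real.one_rpow, Finset.prod_const_one, mul_one] at h
    calc _ ≤ ‖ζ‖ * (1 + ‖ζ‖) ^ (s + ε) := h
      _ ≤ 1 * (1 + 1) ^ (s + ε) := by gcongr
      _ = 2 ^ (s + ε) := by norm_num
  refine finCov_hasFlexibleSplit 1 (av := fun _ => s) (av' := fun _ => s)
    (compl_outgoing_triple 1 (a := 0) (b := 1) (c := 2) (d := 3) (e := 4)
      (by decide) (by decide) (by decide) (by decide) (by decide) (by decide) (by decide))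
    (by simp) (by simp) (fun i => (two_mul s).symm) ?_ ?_
  · exact FinCov.of_measurableSet hS (restrictedEstimate_of_bounded (by decide) (by decide)
      (by decide) (by positivity) hW)
  · exact FinCov.of_measurableSet hS (restrictedEstimate_of_bounded (by decide) (by decide)
      (by decide) (by positivity) hW)

/-! ### The regions cover the frequency space -/

/-- If five numbers nearly sum to zero, their absolute values cannot all nearly agree, since a
sum of five signs is odd. -/
lemma exists_sq_sub_sq_large {b x y₀ y₁ y₂ y₃ : ℝ} (hb : 0 < b) (hy : b ≤ |y₀|)
    (h : |-x + y₀ + y₁ + y₂ + y₃| ≤ b / 16) :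
    b ^ 2 / 32 ≤ |x ^ 2 - y₀ ^ 2| ∨ b ^ 2 / 32 ≤ |y₁ ^ 2 - y₀ ^ 2| ∨
      b ^ 2 / 32 ≤ |y₂ ^ 2 - y₀ ^ 2| ∨ b ^ 2 / 32 ≤ |y₃ ^ 2 - y₀ ^ 2| := by
  have key : ∀ y, |y ^ 2 - y₀ ^ 2| < b ^ 2 / 32 → |y - y₀| < b / 32 ∨ |y + y₀| < b / 32 := by
    intro y hlt
    by_contra! hcon
    rw [sq_sub_sq, abs_mul] at hlt
    have h1 : 2 * b ≤ |y + y₀| + |y - y₀| := by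
      have := abs_sub (y + y₀) (y - y₀)
      rw [show y + y₀ - (y - y₀) = 2 * y₀ by ring, abs_mul, abs_two] at this
      linarith
    rcases le_total b |y + y₀| with h2 | h2
    · nlinarith
    · nlinarith
  by_contra! hcon
  obtain ⟨hx, h1, h2, h3⟩ := hcon
  have kx := key x hx
  have k1 := key y₁ h1
  have k2 := key y₂ h2
  have k3 := key y₃ h3
  simp only [abs_lt] at kx k1 k2 k3
  rw [abs_le] at h
  rw [le_abs] at hy
  clear key hx h1 h2 h3
  rcases kx with kx | kx <;> rcases k1 with k1 | k1 <;> rcases k2 with k2 | k2 <;>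
    rcases k3 with k3 | k3 <;> rcases hy with hy | hy <;> linarith

/-- If only two of the ingoing frequencies are large, then, the sum being nearly zero, the absolute
values of these two and of the outgoing frequency cannot all nearly agree. -/
lemma two_large_cases {b t x y₀ y₁ y₃ : ℝ} (hb : 0 < b) (ht : t ≤ b / 160)
    (hy : b ≤ |y₀|) (hy₃ : |y₃| < t) (h : |-x + y₀ + y₁| ≤ b / 20) :
    (b ^ 2 / 32 ≤ |x ^ 2 - y₁ ^ 2| ∧ b ^ 2 / 32 ≤ |y₀ ^ 2 - y₃ ^ 2|) ∨
    (t ≤ |y₁| ∧ b ^ 2 / 32 ≤ |x ^ 2 - y₀ ^ 2| ∧ b ^ 2 / 32 ≤ |y₁ ^ 2 - y₃ ^ 2|) := by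
  have hy3 : y₃ ^ 2 ≤ (b / 160) ^ 2 := by
    rw [← sq_abs]
    have : |y₃| ≤ b / 160 := by linarith
    gcongr
  have hy0 : b ^ 2 ≤ y₀ ^ 2 := by rw [← sq_abs y₀]; gcongr
  by_cases h1 : b ^ 2 / 32 ≤ |x ^ 2 - y₁ ^ 2|
  · exact Or.inl ⟨h1, le_trans (by nlinarith) (le_abs_self _)⟩
  · right
    rw [not_le, sq_sub_sq, abs_mul] at h1
    have h2 : |y₀| - b / 20 ≤ |x - y₁| ∧ |x - y₁| ≤ |y₀| + b / 20 := by
      have e1 := abs_sub_abs_le_abs_sub y₀ (x - y₁)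
      have e2 := abs_sub_abs_le_abs_sub (x - y₁) y₀
      rw [abs_sub_comm (x - y₁)] at e2
      rw [show y₀ - (x - y₁) = -x + y₀ + y₁ by ring] at e1 e2
      constructor <;> linarith
    have h3 : |x + y₁| < b / 16 := by
      by_contra! hcon
      nlinarith
    have h4 : 2 * |y₁| ≥ |x - y₁| - |x + y₁| := by
      have := abs_sub_abs_le_abs_sub (x - y₁) (x + y₁)
      rw [show x - y₁ - (x + y₁) = -(2 * y₁) by ring, abs_neg, abs_mul, abs_two] at this
      linarith
    have h5 : 2 * |x| ≤ |x - y₁| + |x + y₁| := by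
      have := abs_add_le (x - y₁) (x + y₁)
      rw [show x - y₁ + (x + y₁) = 2 * x by ring, abs_mul, abs_two] at this
      linarith
    have h6 : 2 / 5 * b ≤ |y₁| := by linarith
    have h7 : |x| ≤ 3 / 5 * |y₀| := by linarith
    have h8 : (2 / 5 * b) ^ 2 ≤ y₁ ^ 2 := by rw [← sq_abs y₁]; gcongr
    have h9 : x ^ 2 ≤ (3 / 5) ^ 2 * y₀ ^ 2 := by
      rw [← sq_abs x, ← sq_abs y₀, ← mul_pow]; gcongr
    refine ⟨by linarith, le_trans ?_ (neg_le_abs _), le_trans ?_ (le_abs_self _)⟩ <;> nlinarith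

/-- The ingoing frequencies are sorted by size, and the cases are distinguished by how many of them
exceed `κ * ‖ζ‖`. On `Gam c σ` the largest one is at least `‖ζ‖ / (5 + c)`. -/
lemma exists_region {c κ : ℝ} (hc : 0 < c) (hκ : κ = (1 / (5 + c)) ^ 2 / 32)
    {ζ : Fin 6 → ℝ} (hζ : ζ ∉ regionTrivial c) :
    ζ ∈ regionLarge κ ∨ ∃ π : Equiv.Perm (Fin 5), ζ ∈ regionMixed κ π 0 ∨
      ζ ∈ regionMixed κ π (π 2).succ ∨ ζ ∈ regionNonstationary κ π := by
  obtain ⟨hN, hσ⟩ := not_not.1 hζ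
  set π : Equiv.Perm (Fin 5) := Tuple.sort fun j : Fin 5 => -|ζ j.succ| with hπ
  have hmono : ∀ i j : Fin 5, i ≤ j → |ζ (π j).succ| ≤ |ζ (π i).succ| := fun i j hij =>
    neg_le_neg_iff.1 (Tuple.monotone_sort (fun j : Fin 5 => -|ζ j.succ|) hij)
  have hsum : ∑ i, sgn i * ζ i = -ζ 0 + ζ (π 0).succ + ζ (π 1).succ + ζ (π 2).succ
      + ζ (π 3).succ + ζ (π 4).succ := by
    rw [Fin.sum_univ_succ, ← Equiv.sum_comp π, Fin.sum_univ_five]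
    simp [sgn]
    ring
  have hσ4 := hσ (π 4)
  rw [hsum] at hσ4
  have m01 := hmono 0 1 (by decide)
  have m12 := hmono 1 2 (by decide)
  have m23 := hmono 2 3 (by decide)
  have m34 := hmono 3 4 (by decide)
  have hle : ‖ζ‖ ≤ (5 + c) * |ζ (π 0).succ| := by
    have h0 := abs_nonneg (ζ (π 0).succ)
    rw [pi_norm_le_iff_of_nonneg (by positivity)]
    refine fun j => Fin.cases ?_ (fun j => ?_) j
    · have h4 : c * |ζ (π 4).succ| ≤ c * |ζ (π 0).succ| :=
        mul_le_mul_of_nonneg_left (by linarith) hc.le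
      rw [abs_le] at hσ4
      rw [Real.norm_eq_abs, abs_le]
      have a0 := abs_le.1 (le_refl |ζ (π 0).succ|)
      have a1 := abs_le.1 (le_refl |ζ (π 1).succ|)
      have a2 := abs_le.1 (le_refl |ζ (π 2).succ|)
      have a3 := abs_le.1 (le_refl |ζ (π 3).succ|)
      have a4 := abs_le.1 (le_refl |ζ (π 4).succ|)
      constructor <;> linarith
    · obtain ⟨i, rfl⟩ := π.surjective j
      have := hmono 0 i (Fin.zero_le _)
      rw [Real.norm_eq_abs]
      nlinarith
  set b : ℝ := ‖ζ‖ / (5 + c) with hb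
  have hb0 : 0 < b := by positivity
  have hby : b ≤ |ζ (π 0).succ| := by
    rw [hb, div_le_iff₀ (by positivity), mul_comm]; exact hle
  have ht : (5 + c) * (κ * ‖ζ‖) = b / 32 := by rw [hκ, hb]; field_simp
  have hκN : κ * ‖ζ‖ ^ 2 = b ^ 2 / 32 := by rw [hκ, hb]; field_simp
  have ht0 : 0 < κ * ‖ζ‖ := by rw [hκ]; positivity
  have hct : 0 < c * (κ * ‖ζ‖) := by positivity
  by_cases h4 : κ * ‖ζ‖ ≤ |ζ (π 4).succ|
  · refine Or.inl ⟨hN, fun j => ?_⟩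
    obtain ⟨i, rfl⟩ := π.surjective j
    exact h4.trans (hmono i 4 (Fin.le_last i))
  right
  rw [not_le] at h4
  have hσ' : c * |ζ (π 4).succ| ≤ c * (κ * ‖ζ‖) := by gcongr
  have a4 := abs_lt.1 h4
  have hσ'' := abs_le.1 (hσ4.trans hσ')
  have hy3 : |ζ (π 3).succ| < κ * ‖ζ‖ → b ^ 2 / 32 ≤ |ζ (π 0).succ ^ 2 - ζ (π 3).succ ^ 2| := by
    intro h3
    have e0 : b ^ 2 ≤ ζ (π 0).succ ^ 2 := by rw [← sq_abs (ζ (π 0).succ)]; gcongr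
    have e3 : ζ (π 3).succ ^ 2 ≤ (b / 160) ^ 2 := by
      rw [← sq_abs]
      have : |ζ (π 3).succ| ≤ b / 160 := by linarith
      gcongr
    exact le_trans (by nlinarith) (le_abs_self _)
  have hperm : ∀ {v : Fin 5 → Fin 5} (hv : Function.Injective v), ∃ τ : Equiv.Perm (Fin 5),
      ∀ i, τ i = π (v i) := fun {v} hv =>
    ⟨(Equiv.ofBijective v (Finite.injective_iff_bijective.1 hv)).trans π, fun i => rfl⟩
  -- four large ingoing frequencies: `π 0` is paired with one of different absolute value
  by_cases h3 : κ * ‖ζ‖ ≤ |ζ (π 3).succ|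
  · have h40 : |ζ (π 4).succ| ≤ |ζ (π 0).succ| := by linarith
    have h2 := h3.trans m23
    have h1 := h2.trans m12
    rcases exists_sq_sub_sq_large (x := ζ 0) (y₁ := ζ (π 1).succ) (y₂ := ζ (π 2).succ)
      (y₃ := ζ (π 3).succ) hb0 hby (by rw [abs_le]; constructor <;> linarith) with h | h | h | h
    · obtain ⟨τ, hτ⟩ := hperm (v := ![0, 4, 1, 2, 3]) (by decide)
      refine ⟨τ, Or.inl ?_⟩
      simp only [regionMixed, hτ]
      exact ⟨hN, h1, h2, h3, hκN.trans_le h, h40⟩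
    · obtain ⟨τ, hτ⟩ := hperm (v := ![0, 4, 1, 2, 3]) (by decide)
      refine ⟨τ, Or.inr (Or.inl ?_)⟩
      simp only [regionMixed, hτ]
      exact ⟨hN, h1, h2, h3, hκN.trans_le h, h40⟩
    · obtain ⟨τ, hτ⟩ := hperm (v := ![0, 4, 2, 1, 3]) (by decide)
      refine ⟨τ, Or.inr (Or.inl ?_)⟩
      simp only [regionMixed, hτ]
      exact ⟨hN, h2, h1, h3, hκN.trans_le h, h40⟩
    · obtain ⟨τ, hτ⟩ := hperm (v := ![0, 4, 3, 1, 2]) (by decide)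
      refine ⟨τ, Or.inr (Or.inl ?_)⟩
      simp only [regionMixed, hτ]
      exact ⟨hN, h3, h1, h2, hκN.trans_le h, h40⟩
  rw [not_le] at h3
  have a3 := abs_lt.1 h3
  -- three large ingoing frequencies: the large `π 0` is paired with the small `π 3`
  by_cases h2 : κ * ‖ζ‖ ≤ |ζ (π 2).succ|
  · obtain ⟨τ, hτ⟩ := hperm (v := ![3, 4, 0, 1, 2]) (by decide)
    refine ⟨τ, Or.inr (Or.inl ?_)⟩
    simp only [regionMixed, hτ]
    exact ⟨hN, (h2.trans m12).trans m01, h2.trans m12, h2, hκN.trans_le (hy3 h3), m34⟩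
  rw [not_le] at h2
  have a2 := abs_lt.1 h2
  -- at most two: the outgoing frequency is paired with `π 1` or with `π 0`
  rcases two_large_cases (x := ζ 0) (y₁ := ζ (π 1).succ) hb0 (by linarith) hby h3
    (by rw [abs_le]; constructor <;> linarith) with h | h
  · refine ⟨π, Or.inr (Or.inr ?_)⟩
    simp only [regionNonstationary]
    exact ⟨hN, by linarith, hκN.trans_le h.1, hκN.trans_le h.2, m12, m34⟩
  · obtain ⟨τ, hτ⟩ := hperm (v := ![1, 0, 2, 3, 4]) (by decide)
    refine ⟨τ, Or.inr (Or.inr ?_)⟩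
    simp only [regionNonstationary, hτ]
    exact ⟨hN, h.1, hκN.trans_le h.2.1, hκN.trans_le h.2.2, m12.trans m01, m34⟩

lemma flexibleEstimate_of_lt_quarter {s ε : ℝ} (hs : 0 < s) (hs' : s < 1 / 4) (hε : 0 ≤ ε)
    (hεs : ε < 4 * s) :
    FlexibleEstimate (k := 5) kdvMultiplier kdvResonance s ε := by
  refine flexibleEstimate_of_finCov fun c hc => ?_
  obtain ⟨κ, hκ⟩ : ∃ κ : ℝ, κ = (1 / (5 + c)) ^ 2 / 32 := ⟨_, rfl⟩
  have hκ0 : 0 < κ := by rw [hκ]; positivity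
  have hκ1 : κ ≤ 1 := by
    have h1 : 1 / (5 + c) ≤ 1 := by rw [div_le_one (by positivity)]; linarith
    have h2 : (1 / (5 + c)) ^ 2 ≤ 1 := pow_le_one₀ (by positivity) h1
    linarith
  refine ((finCov_regionTrivial hs hε).union ((finCov_regionLarge hs hs' hε hεs hκ0).union
    (FinCov.iUnion fun π => (finCov_regionMixed_outgoing hs hs' hε hεs hκ0 hκ1 π).union
      ((finCov_regionMixed_ingoing hs hs' hε hεs hκ0 hκ1 π).union
        (finCov_regionNonstationary hs hs' hε hεs hκ0 hκ1 π))))).mono (fun ζ _ => ?_) fun R h => h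
  by_cases hζ : ζ ∈ regionTrivial c
  · exact Or.inl hζ
  · rcases exists_region hc hκ hζ with h | ⟨π, h⟩
    · exact Or.inr (Or.inl h)
    · exact Or.inr (Or.inr (Set.mem_iUnion.2 ⟨π, h⟩))

/-! ### Monotonicity in the regularity and in the gain -/

/-- On `Gam c σ` the outgoing frequency is controlled by the ingoing ones. -/
lemma jap_zero_le_of_mem_Gam {k : ℕ} {c σ : ℝ} (hc : 0 < c) {ζ : Fin (k + 1 + 1) → ℝ}
    (h : ζ ∈ Gam c σ) : jap (ζ 0) ≤ (1 + (k + 1) + c) * ∏ j : Fin (k + 1), jap (ζ j.succ) := by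
  set P := ∏ j : Fin (k + 1), jap (ζ j.succ)
  have hP : ∀ i : Fin (k + 1), jap (ζ i.succ) ≤ P := by
    intro i
    calc jap (ζ i.succ) = ∏ j : Fin (k + 1), if i = j then jap (ζ j.succ) else 1 := by simp
      _ ≤ P := Finset.prod_le_prod
          (fun j _ => by split_ifs; exacts [(jap_pos _).le, zero_le_one])
          fun j _ => by split_ifs; exacts [le_rfl, one_le_jap _]
  have h0 : |ζ 0| ≤ ∑ j : Fin (k + 1), |ζ j.succ| + |σ| := by
    rw [← add_sub_cancel_right (ζ 0) σ, h.1]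
    exact (abs_sub _ _).trans (by gcongr; exact Finset.abs_sum_le_sum_abs _ _)
  have h1 : ∑ j : Fin (k + 1), |ζ j.succ| ≤ (k + 1) * P := by
    have := Finset.sum_le_card_nsmul Finset.univ (fun j : Fin (k + 1) => |ζ j.succ|) P
      fun j _ => (abs_le_jap _).trans (hP j)
    simpa using this
  have h2 : |σ| ≤ c * P := (h.2 0).trans (by gcongr; exact (abs_le_jap _).trans (hP 0))
  have h3 : 1 ≤ P := (one_le_jap _).trans (hP 0)
  have h4 := jap_le (ζ 0)
  linarith

lemma FlexibleEstimate.mono {k : ℕ} {m Φ : (Fin (k + 1 + 1) → ℝ) → ℝ} {s s' ε ε' : ℝ}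
    (h : FlexibleEstimate m Φ s' ε') (hs : s' ≤ s) (hε : ε ≤ ε') : FlexibleEstimate m Φ s ε := by
  intro c hc
  obtain ⟨n, R, hR, hcov, h⟩ := h c hc
  refine ⟨n, R, hR, hcov, fun i => ?_⟩
  obtain ⟨A, hA, hA', a, a', e, e', ha, he, h1, h2⟩ := h i
  have hd : 0 ≤ s - s' := sub_nonneg.2 hs
  have hweight : ∀ (a : Fin (k + 1 + 1) → ℝ) (e σ : ℝ), ∀ ζ ∈ Gam c σ,
      weight m (fun j => a j + (s - s')) (e + (ε - ε')) ζ
        ≤ (1 + (k + 1) + c) ^ (s - s') * weight m a e ζ := by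
    intro a e σ ζ hζ
    have hj : ∀ j, 0 < jap (ζ j) := fun j => jap_pos _
    have h0 : 0 ≤ ∏ j : Fin (k + 1), jap (ζ j.succ) := Finset.prod_nonneg fun j _ => (hj _).le
    have hprod : ∏ j : Fin (k + 1), jap (ζ j.succ) ^ (a j.succ + (s - s'))
        = (∏ j : Fin (k + 1), jap (ζ j.succ) ^ a j.succ)
          * (∏ j : Fin (k + 1), jap (ζ j.succ)) ^ (s - s') := by
      rw [← Real.finsetProd_rpow _ _ fun j _ => (hj _).le, ← Finset.prod_mul_distrib]
      exact Finset.prod_congr rfl fun j _ => Real.rpow_add (hj _) _ _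
    have hpos : 0 < ∏ j : Fin (k + 1), jap (ζ j.succ) ^ a j.succ :=
      Finset.prod_pos fun j _ => Real.rpow_pos_of_pos (hj _) _
    have hpos' : 0 < (∏ j : Fin (k + 1), jap (ζ j.succ)) ^ (s - s') :=
      Real.rpow_pos_of_pos (Finset.prod_pos fun j _ => hj _) _
    have hnum : jap (ζ 0) ^ (a 0 + (s - s') + (e + (ε - ε'))) ≤ jap (ζ 0) ^ (a 0 + e) *
        ((1 + (k + 1) + c) ^ (s - s') * (∏ j : Fin (k + 1), jap (ζ j.succ)) ^ (s - s')) := by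
      calc jap (ζ 0) ^ (a 0 + (s - s') + (e + (ε - ε')))
          ≤ jap (ζ 0) ^ (a 0 + e + (s - s')) :=
            Real.rpow_le_rpow_of_exponent_le (one_le_jap _) (by linarith)
        _ = jap (ζ 0) ^ (a 0 + e) * jap (ζ 0) ^ (s - s') := Real.rpow_add (hj 0) _ _
        _ ≤ _ := by
            rw [← Real.mul_rpow (by positivity) h0]
            exact mul_le_mul_of_nonneg_left (Real.rpow_le_rpow (hj 0).le
              (jap_zero_le_of_mem_Gam hc hζ) hd) (Real.rpow_nonneg (hj 0).le _)
    rw [weight, weight, hprod, ← mul_div_assoc, div_le_div_iff₀ (by positivity) hpos]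
    calc _ ≤ |m ζ| * (jap (ζ 0) ^ (a 0 + e) *
          ((1 + (k + 1) + c) ^ (s - s') * (∏ j : Fin (k + 1), jap (ζ j.succ)) ^ (s - s')))
          * ∏ j : Fin (k + 1), jap (ζ j.succ) ^ a j.succ := by gcongr
      _ = _ := by ring
  have hK : 0 < (1 + (k + 1 : ℝ) + c) ^ (s - s') := by positivity
  exact ⟨A, hA, hA', fun j => a j + (s - s'), fun j => a' j + (s - s'), e + (ε - ε'),
    e' + (ε - ε'), fun j => by linarith [ha j], by linarith,
    h1.mono hK subset_rfl (hweight a e), h2.mono hK subset_rfl (hweight a' e')⟩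

end FlexFRE

theorem proposition3p1 (s ε : ℝ) (hs : 0 < s) (hε : ε < min (4 * s) 1) :
    FlexFRE.FlexibleEstimate (k := 5) FlexFRE.kdvMultiplier FlexFRE.kdvResonance s ε := by
  obtain ⟨t, ht, ht'⟩ := exists_between (max_lt hε (show 0 < min (4 * s) 1 by positivity))
  obtain ⟨hεt, h0t⟩ := max_lt_iff.1 ht
  obtain ⟨hts, ht1⟩ := lt_min_iff.1 ht'
  exact (FlexFRE.flexibleEstimate_of_lt_quarter (s := t / 4) (ε := max ε 0) (by linarith)
    (by linarith) (le_max_right _ _) (by linarith)).mono (by linarith) (le_max_left _ _)
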